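/- Let $d\ge 1$. A dyadic cube is an open cube $\prod_i(2^km_i,2^k(m_i+1))\subset\mathbb R^d$ with $k\in\mathbb Z$, $m\in\mathbb Z^d$; $\ell(Q)$ is its side length, $x_Q$ its center, $tQ$ the concentric open cube of side $t\,\ell(Q)$, and ${\rm D}(Q,S)=\ell(Q)+\ell(S)+{\rm dist}(Q,S)$. A domain is a non-empty connected open set. A family $\mathcal W$ of dyadic cubes is a Whitney covering of a domain $\Omega\subset\mathbb R^d$ if its cubes are pairwise disjoint, $\bigcup_{Q\in\mathcal W}\overline Q=\Omega$, there is $C_{\mathcal W}>0$ with $C_{\mathcal W}\ell(Q)\le{\rm dist}(Q,\partial\Omega)\le 4C_{\mathcal W}\ell(Q)$ for all $Q\in\mathcal W$, the number of $Q\in\mathcal W$ with $x\in 50Q$ is bounded uniformly in $x$, and $\ell(S)\ge\frac12\ell(Q)$ whenever $Q,S\in\mathcal W$ and $S\subset5Q$. For $\varepsilon>0$, an $\varepsilon$-admissible chain $[Q,S]$ is a tuple $(Q_1,\dots,Q_M)$ in $\mathcal W$ with $Q_1=Q$, $Q_M=S$, $\overline{Q_j}\cap\overline{Q_{j+1}}\neq\emptyset$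 for $j<M$, $\sum_{j=1}^M\ell(Q_j)\le\frac1\varepsilon{\rm D}(Q,S)$, together with an index $1\le j_0<M$ such that $\ell(Q_j)\ge\varepsilon{\rm D}(Q,Q_j)$ for $j\le j_0$ and $\ell(Q_j)\ge\varepsilon{\rm D}(Q_j,S)$ for $j\ge j_0$; its central cube is $Q_{j_0}$. We say that $\Omega$ is an $\varepsilon$-uniform domain with admissible Whitney covering $\mathcal W$ if any two cubes of $\mathcal W$ (possibly equal) are joined by an $\varepsilon$-admissible chain. For $\rho\in\mathbb R$ let $\mathbf{SH}_\rho(P)=\{Q\in\mathcal W:Q\subset B(x_P,\rho\,\ell(P))\}$ and ${\rm Sh}_\rho(P)=\bigcup_{Q\in\mathbf{SH}_\rho(P)}Q$. Call $\rho$ a shadow parameter of $(\varepsilon,\mathcal W)$ if $\rho>1$ and, for every $\varepsilon$-admissible chain $(Q_1,\dots,Q_M)$ and every admissible choice of its central index $j_0$, $Q_1\in\mathbf{SH}_\rho(Q_j)$ for all $j\le j_0$ and $Q_j\in\mathbf{SH}_\rho(Q_{j_0})$ for all $j$. For $0<s<1$, $1\le p<\infty$, $1\le q\le\infty$ and $f\in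 L^1_{\rm loc}(\Omega)$ (complex-valued), put $$\|f\|_{\dot A^s_{p,q}(\Omega)}=\left(\int_\Omega\left(\int_\Omega\frac{|f(x)-f(y)|^q}{|x-y|^{sq+d}}\,dy\right)^{\frac pq}dx\right)^{\frac1p},$$ $$\|f\|_{\widetilde A^s_{p,q}(\Omega)}=\left(\sum_{Q\in\mathcal W}\int_Q\left(\int_{{\rm Sh}_\rho(Q)}\frac{|f(x)-f(y)|^q}{|x-y|^{sq+d}}\,dy\right)^{\frac pq}dx\right)^{\frac1p}\in[0,\infty],$$ where for $q=\infty$ the inner expression $\left(\int_A\frac{|f(x)-f(y)|^q}{|x-y|^{sq+d}}dy\right)^{1/q}$ is replaced by $\operatorname{ess\,sup}_{y\in A}\frac{|f(x)-f(y)|}{|x-y|^s}$. Theorem. (i) For all $d\ge1$, $\varepsilon>0$ there is $\rho_\varepsilon$, depending only on $d$ and $\varepsilon$, which is a shadow parameter of $(\varepsilon,\mathcal W)$ for every $\varepsilon$-uniform domain $\Omega\subset\mathbb R^d$ with admissible Whitney covering $\mathcal W$. (ii) For all $d\ge 1$, $\varepsilon>0$, $\rho\in\mathbb R$, $0<s<1$,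 $1\le p<\infty$, $1\le q\le\infty$ there is a finite constant $C=C(d,\varepsilon,\rho,s,p,q)$ such that for every $\varepsilon$-uniform domain $\Omega\subset\mathbb R^d$ with admissible Whitney covering $\mathcal W$ for which $\rho$ is a shadow parameter, and every $f\in L^1_{\rm loc}(\Omega)$, $$\|f\|_{\widetilde A^s_{p,q}(\Omega)}\le C\,\|f\|_{\dot A^s_{p,q}(\Omega)}\quad\text{and}\quad\|f\|_{\dot A^s_{p,q}(\Omega)}\le C\,\|f\|_{\widetilde A^s_{p,q}(\Omega)}.$$ -/

import Mathlib

open MeasureTheory Set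
open scoped ENNReal NNReal

noncomputable section

namespace UniformDomain

/-- The open dyadic cube `∏ i, (2 ^ k * m i, 2 ^ k * (m i + 1))` of `ℝ^d`,
where `k = scale` and `m = index`. -/
structure DyadicCube (d : ℕ) where
  scale : ℤ
  index : Fin d → ℤ

namespace DyadicCube

variable {d : ℕ}

/-- The side length `ℓ(Q)`. -/
def side (Q : DyadicCube d) : ℝ := (2 : ℝ) ^ Q.scale

/-- The center `x_Q`. -/
def center (Q : DyadicCube d) : EuclideanSpace ℝ (Fin d) :=
  WithLp.toLp 2 (fun i => Q.side * ((Q.index i : ℝ) + 1 / 2))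

/-- The open cube itself, as a set of points. -/
def toSet (Q : DyadicCube d) : Set (EuclideanSpace ℝ (Fin d)) :=
  {x | ∀ i, Q.side * (Q.index i : ℝ) < x i ∧ x i < Q.side * ((Q.index i : ℝ) + 1)}

/-- The open cube `t Q`, concentric with `Q` and with side length `t * ℓ(Q)`. -/
def dilate (t : ℝ) (Q : DyadicCube d) : Set (EuclideanSpace ℝ (Fin d)) :=
  {x | ∀ i, |x i - Q.center i| < t * Q.side / 2}

end DyadicCube

/-- The distance between two sets, with value `∞` if one of them is empty. -/
def setEDist {d : ℕ} (A B : Set (EuclideanSpace ℝ (Fin d))) : ℝ≥0∞ :=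
  ⨅ x ∈ A, ⨅ y ∈ B, edist x y

/-- The long distance `D(Q, S) = ℓ(Q) + ℓ(S) + dist(Q, S)`. -/
def longDist {d : ℕ} (Q S : DyadicCube d) : ℝ :=
  Q.side + S.side + (setEDist Q.toSet S.toSet).toReal

/-- Two cubes are neighbors if their closures meet. -/
def Neighbors {d : ℕ} (Q S : DyadicCube d) : Prop :=
  (closure Q.toSet ∩ closure S.toSet).Nonempty

/-- Whitney coverings of an open set `Ω`. -/
structure IsWhitneyCovering {d : ℕ} (Ω : Set (EuclideanSpace ℝ (Fin d)))
    (W : Set (DyadicCube d)) : Prop where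
  disjoint : ∀ Q ∈ W, ∀ S ∈ W, Q ≠ S → Disjoint Q.toSet S.toSet
  cover : ⋃ Q ∈ W, closure Q.toSet = Ω
  dist_boundary : ∃ C : ℝ, 0 < C ∧ ∀ Q ∈ W,
    ENNReal.ofReal (C * Q.side) ≤ setEDist Q.toSet (frontier Ω) ∧
      setEDist Q.toSet (frontier Ω) ≤ ENNReal.ofReal (4 * C * Q.side)
  finite_superposition : ∃ N : ℕ, ∀ x : EuclideanSpace ℝ (Fin d),
    {Q ∈ W | x ∈ Q.dilate 50}.encard ≤ N
  side_le : ∀ Q ∈ W, ∀ S ∈ W, S.toSet ⊆ Q.dilate 5 → Q.side / 2 ≤ S.side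

/-- The tuple `c 0, …, c n` of cubes of `W` is an `ε`-admissible chain connecting `Q` and `S`,
with central cube `c j₀`; the central position is not the last one. -/
structure IsAdmissibleChain {d : ℕ} (W : Set (DyadicCube d)) (ε : ℝ) (Q S : DyadicCube d)
    {n : ℕ} (c : Fin (n + 1) → DyadicCube d) (j₀ : Fin n) : Prop where
  mem : ∀ j, c j ∈ W
  first : c 0 = Q
  last : c (Fin.last n) = S
  neighbors : ∀ j : Fin n, Neighbors (c j.castSucc) (c j.succ)
  length_le : ∑ j, (c j).side ≤ 1 / ε * longDist Q S
  ascending : ∀ j, j ≤ j₀.castSucc → ε * longDist Q (c j) ≤ (c j).side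
  descending : ∀ j, j₀.castSucc ≤ j → ε * longDist (c j) S ≤ (c j).side

/-- `Ω` is an `ε`-uniform domain, as witnessed by its (admissible) Whitney covering `W`: any two
cubes of `W` are connected by an `ε`-admissible chain. -/
structure IsUniformDomainWith {d : ℕ} (ε : ℝ) (Ω : Set (EuclideanSpace ℝ (Fin d)))
    (W : Set (DyadicCube d)) : Prop where
  isOpen : IsOpen Ω
  isConnected : IsConnected Ω
  whitney : IsWhitneyCovering Ω W
  exists_chain : ∀ Q ∈ W, ∀ S ∈ W, ∃ (n : ℕ) (c : Fin (n + 1) → DyadicCube d) (j₀ : Fin n),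
    IsAdmissibleChain W ε Q S c j₀

/-- The `ρ`-shadow of `P`, as a family of cubes. -/
def shadowCubes {d : ℕ} (W : Set (DyadicCube d)) (ρ : ℝ) (P : DyadicCube d) :
    Set (DyadicCube d) :=
  {Q ∈ W | Q.toSet ⊆ Metric.ball P.center (ρ * P.side)}

/-- The realization of the `ρ`-shadow of `P`, as a set of points. -/
def shadow {d : ℕ} (W : Set (DyadicCube d)) (ρ : ℝ) (P : DyadicCube d) :
    Set (EuclideanSpace ℝ (Fin d)) :=
  ⋃ Q ∈ shadowCubes W ρ P, Q.toSet

/-- The requirements on the parameter `ρ_ε` of the shadows: `ρ > 1`, and for every `ε`-admissible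
chain `[Q, S]` with central cube `Q_S`, one has `Q ∈ SH_ρ(P)` for every `P ∈ [Q, Q_S]`, and
`P ∈ SH_ρ(Q_S)` for every `P ∈ [Q, S]`. -/
structure IsShadowParameter {d : ℕ} (ε : ℝ) (W : Set (DyadicCube d)) (ρ : ℝ) : Prop where
  one_lt : 1 < ρ
  first_mem : ∀ (Q S : DyadicCube d) (n : ℕ) (c : Fin (n + 1) → DyadicCube d) (j₀ : Fin n),
    IsAdmissibleChain W ε Q S c j₀ → ∀ j, j ≤ j₀.castSucc → Q ∈ shadowCubes W ρ (c j)
  mem_central : ∀ (Q S : DyadicCube d) (n : ℕ) (c : Fin (n + 1) → DyadicCube d) (j₀ : Fin n),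
    IsAdmissibleChain W ε Q S c j₀ → ∀ j, c j ∈ shadowCubes W ρ (c j₀.castSucc)

/-- `(∫_A |f(x) - f(y)|^q / |x - y|^(s q + d) dy)^(1/q)`, and for `q = ∞` the essential supremum
of `|f(x) - f(y)| / |x - y|^s` over `y ∈ A`. -/
def innerNorm {d : ℕ} (s : ℝ) (q : ℝ≥0∞) (f : EuclideanSpace ℝ (Fin d) → ℂ)
    (A : Set (EuclideanSpace ℝ (Fin d))) (x : EuclideanSpace ℝ (Fin d)) : ℝ≥0∞ :=
  if q = ∞ then
    essSup (fun y => ‖f x - f y‖ₑ / ‖x - y‖ₑ ^ s) (volume.restrict A)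
  else
    (∫⁻ y in A, ‖f x - f y‖ₑ ^ q.toReal / ‖x - y‖ₑ ^ (s * q.toReal + d)) ^ (1 / q.toReal)

/-- The seminorm of `f` in the homogeneous space `Ȧ^s_{p,q}(Ω)`. -/
def fullSeminorm {d : ℕ} (s p : ℝ) (q : ℝ≥0∞) (Ω : Set (EuclideanSpace ℝ (Fin d)))
    (f : EuclideanSpace ℝ (Fin d) → ℂ) : ℝ≥0∞ :=
  (∫⁻ x in Ω, innerNorm s q f Ω x ^ p) ^ (1 / p)

/-- The seminorm `Ã^s_{p,q}(Ω)`, where for `x` in the Whitney cube `Q` the variable `y` is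
restricted to the `ρ`-shadow of `Q`. -/
def shadowSeminorm {d : ℕ} (s p : ℝ) (q : ℝ≥0∞) (W : Set (DyadicCube d)) (ρ : ℝ)
    (f : EuclideanSpace ℝ (Fin d) → ℂ) : ℝ≥0∞ :=
  (∑' Q : W, ∫⁻ x in Q.1.toSet, innerNorm s q f (shadow W ρ Q.1) x ^ p) ^ (1 / p)

end UniformDomain

end

/-!
The shadow seminorm is at most the full one because the Whitney cubes are disjoint and all shadows lie
in `Ω`. For the converse, put `t = s + d / q`, so that the inner norm is the `L^q` norm in `y` of the
difference quotient `|f x - f y| / |x - y| ^ t` (`innerNorm_eq_eLpNorm`), for all `q` including `∞`.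
Only Minkowski's inequality in `L^q` is used, and no measurability of `f` beyond that of a
representative. In every Whitney cube `P` a point `u P` is chosen at which the inner norm `b P` over
the shadow of `P` is at most its `L^p` average over `P`; these values replace the averages of `f`.

Let `x` lie in the Whitney cube `Q`. Over a cube `S` that is not a neighbor of `Q`, the difference
`f x - f y` is telescoped through the points `u P` of the ascending part of an admissible chain, and
then from the central cube directly to `y`, which lies in the shadow of that cube. One step of the
chain at a cube `P` costs `ℓ(P) ^ s * b P` (`enorm_sub_le_of_neighbors`), and it occurs only if
`ℓ(P)` is at most comparable to `|x - y|`; the `L^q` norm of `|x - y| ^ (-t)` over this range is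
comparable to `ℓ(P) ^ (-s)` (`exists_eLpNorm_tailKernel_le`). Hence the distant part of the inner norm
is controlled by the sum of `b P` over all `P` whose shadow contains `Q` (`exists_innerNorm_far_le`).

For an arbitrary shadow parameter, the shadow of `Q` may miss neighbors `S` of twice the size of `Q`.
For these, the coordinate reflection across the separating faces maps `Q` into `S`, and the inner norm
over `S` at `x` is controlled by the inner norms over shadows at `x` and at its mirror image
(`exists_innerNorm_neighbor_le`).

It remains to bound the operator that sums `b P` over all `P` whose shadow contains `Q`, in `ℓ^p` with
weights `|Q|` (`exists_tsum_rpow_tsum_shadow_le`). Admissible chains show that Whitney cubes are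
porous: each dyadic cube of `ℝ^d` has a descendant of a fixed generation without Whitney cubes in it
(`exists_descendant_forall_not_mem`). By iteration, the cubes in a shadow satisfy a packing condition
with an exponent smaller than `d`, which is what Hölder's inequality with power weights requires.
-/

namespace UniformDomain

/-! ### Dyadic cubes -/

theorem abs_sub_apply_le_dist {d : ℕ} (x y : EuclideanSpace ℝ (Fin d)) (i : Fin d) :
    |x i - y i| ≤ dist x y := by
  rw [dist_eq_norm]
  simpa using PiLp.norm_apply_le (x - y) i

theorem dist_le_sqrt_mul {d : ℕ} {x y : EuclideanSpace ℝ (Fin d)} {r : ℝ} (hr : 0 ≤ r)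
    (h : ∀ i, |x i - y i| ≤ r) : dist x y ≤ √d * r := by
  rw [EuclideanSpace.dist_eq, ← Real.sqrt_sq hr, ← Real.sqrt_mul (Nat.cast_nonneg d)]
  refine Real.sqrt_le_sqrt ?_
  calc ∑ i, dist (x i) (y i) ^ 2 ≤ ∑ _i : Fin d, r ^ 2 := by
        refine Finset.sum_le_sum fun i _ => ?_
        rw [Real.dist_eq]
        exact pow_le_pow_left₀ (abs_nonneg _) (h i) 2
    _ = d * r ^ 2 := by simp

theorem volume_box {d : ℕ} (a b : Fin d → ℝ) :
    volume {x : EuclideanSpace ℝ (Fin d) | ∀ i, a i < x i ∧ x i < b i} =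
      ∏ i, ENNReal.ofReal (b i - a i) := by
  rw [← Real.volume_pi_Ioo,
    ← (PiLp.volume_preserving_ofLp (Fin d)).measure_preimage
      (MeasurableSet.univ_pi fun i => measurableSet_Ioo).nullMeasurableSet]
  congr 1
  ext x
  simp

theorem isOpen_box {d : ℕ} (a b : Fin d → ℝ) :
    IsOpen {x : EuclideanSpace ℝ (Fin d) | ∀ i, a i < x i ∧ x i < b i} := by
  simp only [Set.ofPred_forall]
  refine isOpen_iInter_of_finite fun i => ?_
  have h : Continuous fun x : EuclideanSpace ℝ (Fin d) => x i := by fun_prop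
  exact (isOpen_lt continuous_const h).inter (isOpen_lt h continuous_const)

namespace DyadicCube

variable {d : ℕ}

theorem side_pos (Q : DyadicCube d) : 0 < Q.side := by unfold side; positivity

instance : Countable (DyadicCube d) :=
  Function.Injective.countable (f := fun Q : DyadicCube d => (Q.scale, Q.index)) (by
    rintro ⟨a, b⟩ ⟨c, e⟩ h
    simpa using h)

theorem isOpen_toSet (Q : DyadicCube d) : IsOpen Q.toSet := isOpen_box _ _

theorem measurableSet_toSet (Q : DyadicCube d) : MeasurableSet Q.toSet :=
  Q.isOpen_toSet.measurableSet

theorem center_apply (Q : DyadicCube d) (i : Fin d) :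
    Q.center i = Q.side * ((Q.index i : ℝ) + 1 / 2) := rfl

theorem center_mem (Q : DyadicCube d) : Q.center ∈ Q.toSet := by
  intro i
  have := Q.side_pos
  rw [center_apply]
  constructor <;> nlinarith

theorem abs_sub_center_lt {Q : DyadicCube d} {x : EuclideanSpace ℝ (Fin d)} (hx : x ∈ Q.toSet)
    (i : Fin d) : |x i - Q.center i| < Q.side / 2 := by
  have := hx i
  rw [center_apply, abs_lt]
  constructor <;> linarith

theorem abs_sub_lt_side {Q : DyadicCube d} {x y : EuclideanSpace ℝ (Fin d)} (hx : x ∈ Q.toSet)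
    (hy : y ∈ Q.toSet) (i : Fin d) : |x i - y i| < Q.side := by
  have := hx i
  have := hy i
  rw [abs_lt]
  constructor <;> linarith

theorem volume_toSet (Q : DyadicCube d) : volume Q.toSet = ENNReal.ofReal Q.side ^ d := by
  unfold toSet
  rw [volume_box]
  simp [mul_add]

theorem closure_toSet (Q : DyadicCube d) : closure Q.toSet =
    {x | ∀ i, Q.side * (Q.index i : ℝ) ≤ x i ∧ x i ≤ Q.side * ((Q.index i : ℝ) + 1)} := by
  have h : Q.toSet = (PiLp.homeomorph 2 (fun _ : Fin d => ℝ)) ⁻¹'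
      (Set.univ.pi fun i => Ioo (Q.side * (Q.index i : ℝ)) (Q.side * ((Q.index i : ℝ) + 1))) := by
    ext x
    simp only [toSet, mem_preimage, mem_pi, mem_univ, true_imp_iff]
    rfl
  rw [h, ← Homeomorph.preimage_closure, closure_pi_set]
  ext x
  have hs := Q.side_pos
  simp only [mem_preimage, mem_pi, mem_univ, true_imp_iff, mem_ofPred_eq]
  refine forall_congr' fun i => ?_
  rw [closure_Ioo (by intro h; nlinarith)]
  rfl

theorem volume_closure_diff (Q : DyadicCube d) : volume (closure Q.toSet \ Q.toSet) = 0 := by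
  have hc : Convex ℝ Q.toSet := by
    intro x hx y hy a b ha hb hab i
    have h1 := hx i
    have h2 := hy i
    obtain rfl : b = 1 - a := by linarith
    simp only [PiLp.add_apply, PiLp.smul_apply, smul_eq_mul]
    rcases ha.eq_or_lt with rfl | ha
    · simpa using h2
    · constructor <;> nlinarith
  rw [← Q.isOpen_toSet.frontier_eq]
  exact hc.addHaar_frontier volume

theorem side_eq_pow_mul {Q R : DyadicCube d} {j : ℕ} (h : Q.scale + j = R.scale) :
    R.side = 2 ^ j * Q.side := by
  unfold side
  rw [← h, zpow_add₀ two_ne_zero, zpow_natCast, mul_comm]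

theorem side_le_side_iff {Q R : DyadicCube d} : Q.side ≤ R.side ↔ Q.scale ≤ R.scale :=
  zpow_le_zpow_iff_right₀ one_lt_two

/-- `Q` is one of the `2 ^ (j * d)` dyadic subcubes of `R` of side length `2 ^ (-j) * ℓ(R)`. -/
def IsDescendant (j : ℕ) (Q R : DyadicCube d) : Prop :=
  Q.scale + j = R.scale ∧ ∀ i, 2 ^ j * R.index i ≤ Q.index i ∧ Q.index i < 2 ^ j * (R.index i + 1)

theorem IsDescendant.subset {j : ℕ} {Q R : DyadicCube d} (h : IsDescendant j Q R) :
    Q.toSet ⊆ R.toSet := by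
  intro x hx i
  obtain ⟨h1, h2⟩ := h.2 i
  have hs := Q.side_pos
  have h3 : (2 : ℝ) ^ j * R.index i ≤ Q.index i := by exact_mod_cast h1
  have h4 : (Q.index i : ℝ) + 1 ≤ 2 ^ j * (R.index i + 1) := by exact_mod_cast h2
  have := hx i
  rw [side_eq_pow_mul h.1]
  constructor <;> nlinarith

theorem isDescendant_of_mem {j : ℕ} {Q R : DyadicCube d} (h : Q.scale + j = R.scale)
    {x : EuclideanSpace ℝ (Fin d)} (hQ : x ∈ Q.toSet) (hR : x ∈ R.toSet) : IsDescendant j Q R := by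
  refine ⟨h, fun i => ?_⟩
  obtain ⟨h1, h2⟩ := hQ i
  obtain ⟨h3, h4⟩ := hR i
  rw [side_eq_pow_mul h] at h3 h4
  have hs := Q.side_pos
  have h5 : (2 : ℝ) ^ j * R.index i < Q.index i + 1 := by
    refine lt_of_mul_lt_mul_left (a := Q.side) ?_ hs.le
    linarith
  have h6 : (Q.index i : ℝ) < 2 ^ j * (R.index i + 1) := by
    refine lt_of_mul_lt_mul_left (a := Q.side) ?_ hs.le
    linarith
  exact ⟨Int.lt_add_one_iff.1 (by exact_mod_cast h5), by exact_mod_cast h6⟩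

theorem IsDescendant.trans {j k : ℕ} {Q R T : DyadicCube d} (h : IsDescendant j Q R)
    (h' : IsDescendant k R T) : IsDescendant (k + j) Q T := by
  refine isDescendant_of_mem ?_ Q.center_mem (h'.subset (h.subset Q.center_mem))
  have := h.1
  have := h'.1
  push_cast
  omega

/-- The ancestor of `Q` whose side length is `2 ^ j * ℓ(Q)`. -/
def ancestor (j : ℕ) (Q : DyadicCube d) : DyadicCube d :=
  ⟨Q.scale + j, fun i => Q.index i / 2 ^ j⟩

theorem isDescendant_ancestor (j : ℕ) (Q : DyadicCube d) : IsDescendant j Q (Q.ancestor j) := by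
  refine ⟨rfl, fun i => ?_⟩
  have hp : (0 : ℤ) < 2 ^ j := by positivity
  have h1 := Int.emod_add_mul_ediv (Q.index i) (2 ^ j)
  have h2 := Int.emod_nonneg (Q.index i) hp.ne'
  have h3 := Int.emod_lt_of_pos (Q.index i) hp
  simp only [ancestor]
  constructor <;> linarith

/-- The descendant of `Q` of side length `2 ^ (-j) * ℓ(Q)` whose position, in units of its own
side length and relative to the lower corner of `Q`, is `(e, …, e)`. -/
def descendant (j : ℕ) (e : ℤ) (Q : DyadicCube d) : DyadicCube d :=
  ⟨Q.scale - j, fun i => 2 ^ j * Q.index i + e⟩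

theorem isDescendant_descendant {j : ℕ} {e : ℤ} (h0 : 0 ≤ e) (h1 : e < 2 ^ j)
    (Q : DyadicCube d) : IsDescendant j (Q.descendant j e) Q := by
  refine ⟨by simp [descendant], fun i => ?_⟩
  simp only [descendant]
  constructor <;> linarith

theorem subset_of_mem {Q R : DyadicCube d} (h : Q.side ≤ R.side)
    {x : EuclideanSpace ℝ (Fin d)} (hQ : x ∈ Q.toSet) (hR : x ∈ R.toSet) :
    Q.toSet ⊆ R.toSet := by
  rw [side_le_side_iff] at h
  exact (isDescendant_of_mem (j := (R.scale - Q.scale).toNat) (by omega) hQ hR).subset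

end DyadicCube

variable {d : ℕ}

theorem setEDist_ne_top (Q S : DyadicCube d) : setEDist Q.toSet S.toSet ≠ ∞ := by
  refine ne_top_of_le_ne_top (edist_ne_top Q.center S.center) ?_
  exact (iInf₂_le _ Q.center_mem).trans (iInf₂_le _ S.center_mem)

theorem longDist_le {Q S : DyadicCube d} {x y : EuclideanSpace ℝ (Fin d)} (hx : x ∈ Q.toSet)
    (hy : y ∈ S.toSet) : longDist Q S ≤ Q.side + S.side + dist x y := by
  unfold longDist
  gcongr
  rw [dist_edist]
  exact ENNReal.toReal_mono (edist_ne_top _ _) ((iInf₂_le _ hx).trans (iInf₂_le _ hy))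

theorem side_add_side_le_longDist (Q S : DyadicCube d) : Q.side + S.side ≤ longDist Q S := by
  unfold longDist
  simp

/-- The long distance controls the distance of any two points coordinatewise, with constant `1`. -/
theorem abs_sub_le_longDist {Q S : DyadicCube d} {x y : EuclideanSpace ℝ (Fin d)}
    (hx : x ∈ Q.toSet) (hy : y ∈ S.toSet) (i : Fin d) : |x i - y i| ≤ longDist Q S := by
  have h : ENNReal.ofReal (|x i - y i| - Q.side - S.side) ≤ setEDist Q.toSet S.toSet := by
    refine le_iInf₂ fun a ha => le_iInf₂ fun b hb => ?_
    rw [edist_dist]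
    refine ENNReal.ofReal_le_ofReal ?_
    have h1 := DyadicCube.abs_sub_lt_side hx ha i
    have h2 := DyadicCube.abs_sub_lt_side hb hy i
    have h3 := abs_sub_apply_le_dist a b i
    have h4 : |x i - y i| ≤ |x i - a i| + |a i - b i| + |b i - y i| := by
      calc |x i - y i| = |(x i - a i) + (a i - b i) + (b i - y i)| := by ring_nf
        _ ≤ _ := abs_add_three _ _ _
    linarith
  rw [ENNReal.ofReal_le_iff_le_toReal (setEDist_ne_top Q S)] at h
  unfold longDist
  linarith

theorem dist_le_longDist {Q S : DyadicCube d} {x y : EuclideanSpace ℝ (Fin d)}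
    (hx : x ∈ Q.toSet) (hy : y ∈ S.toSet) : dist x y ≤ √d * longDist Q S :=
  dist_le_sqrt_mul (by
    linarith [side_add_side_le_longDist Q S, Q.side_pos, S.side_pos]) (abs_sub_le_longDist hx hy)

theorem longDist_self_le (Q : DyadicCube d) : longDist Q Q ≤ 2 * Q.side := by
  have := longDist_le Q.center_mem Q.center_mem
  rw [dist_self] at this
  linarith

theorem DyadicCube.dist_le {Q : DyadicCube d} {x y : EuclideanSpace ℝ (Fin d)}
    (hx : x ∈ Q.toSet) (hy : y ∈ Q.toSet) : dist x y ≤ √d * Q.side :=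
  dist_le_sqrt_mul Q.side_pos.le fun i => (abs_sub_lt_side hx hy i).le

theorem neighbors_iff {Q S : DyadicCube d} : Neighbors Q S ↔ ∀ i,
    Q.side * (Q.index i : ℝ) ≤ S.side * ((S.index i : ℝ) + 1) ∧
      S.side * (S.index i : ℝ) ≤ Q.side * ((Q.index i : ℝ) + 1) := by
  have hQ := Q.side_pos
  have hS := S.side_pos
  unfold Neighbors
  rw [Q.closure_toSet, S.closure_toSet]
  constructor
  · rintro ⟨x, h1, h2⟩ i
    exact ⟨(h1 i).1.trans (h2 i).2, (h2 i).1.trans (h1 i).2⟩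
  · intro h
    refine ⟨WithLp.toLp 2 fun i => max (Q.side * (Q.index i : ℝ)) (S.side * (S.index i : ℝ)),
      fun i => ⟨le_max_left _ _, max_le (by nlinarith) (h i).2⟩,
      fun i => ⟨le_max_right _ _, max_le (h i).1 (by nlinarith)⟩⟩

theorem Neighbors.symm {Q S : DyadicCube d} (h : Neighbors Q S) : Neighbors S Q := by
  unfold Neighbors at *
  rwa [inter_comm]

theorem Neighbors.abs_sub_le {Q S : DyadicCube d} (h : Neighbors Q S)
    {x y : EuclideanSpace ℝ (Fin d)} (hx : x ∈ Q.toSet) (hy : y ∈ S.toSet) (i : Fin d) :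
    |x i - y i| ≤ Q.side + S.side := by
  have h1 := neighbors_iff.1 h i
  have h2 := hx i
  have h3 := hy i
  rw [abs_le]
  constructor <;> linarith

theorem Neighbors.dist_le {Q S : DyadicCube d} (h : Neighbors Q S)
    {x y : EuclideanSpace ℝ (Fin d)} (hx : x ∈ Q.toSet) (hy : y ∈ S.toSet) :
    dist x y ≤ √d * (Q.side + S.side) :=
  dist_le_sqrt_mul (by linarith [Q.side_pos, S.side_pos]) (h.abs_sub_le hx hy)

/-! ### Admissible chains and shadows -/

section Chains

variable {Ω : Set (EuclideanSpace ℝ (Fin d))} {W : Set (DyadicCube d)} {ε ρ : ℝ}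
  {Q S : DyadicCube d}

theorem IsAdmissibleChain.le_half {n : ℕ} {c : Fin (n + 1) → DyadicCube d} {j₀ : Fin n}
    (h : IsAdmissibleChain W ε Q S c j₀) (hε : 0 < ε) : ε ≤ 1 / 2 := by
  have h1 := h.ascending 0 (Fin.zero_le _)
  rw [h.first] at h1
  have h2 := side_add_side_le_longDist Q Q
  have h3 := Q.side_pos
  by_contra! h4
  nlinarith

/-- The size of the central cube of an admissible chain is at least comparable to the long distance of
the ends of the chain. -/
theorem IsAdmissibleChain.longDist_le_central {n : ℕ} {c : Fin (n + 1) → DyadicCube d}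
    {j₀ : Fin n} (h : IsAdmissibleChain W ε Q S c j₀) (hε : 0 < ε) :
    longDist Q S ≤ 2 * (1 + √d) / ε * (c j₀.castSucc).side := by
  set T := c j₀.castSucc
  have h1 : ε * longDist Q T ≤ T.side := h.ascending _ le_rfl
  have h2 : ε * longDist T S ≤ T.side := h.descending _ le_rfl
  have h3 := side_add_side_le_longDist Q T
  have h4 := side_add_side_le_longDist T S
  have h5 := dist_le_longDist Q.center_mem T.center_mem
  have h6 := dist_le_longDist T.center_mem S.center_mem
  have h7 := longDist_le Q.center_mem S.center_mem
  have h8 := dist_triangle Q.center T.center S.center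
  have h9 := T.side_pos
  have hd := Real.sqrt_nonneg d
  have h10 : longDist Q T ≤ T.side / ε := by rw [le_div_iff₀ hε]; linarith
  have h11 : longDist T S ≤ T.side / ε := by rw [le_div_iff₀ hε]; linarith
  calc longDist Q S ≤ (1 + √d) * (longDist Q T + longDist T S) := by nlinarith
    _ ≤ (1 + √d) * (T.side / ε + T.side / ε) := by gcongr
    _ = _ := by ring

/-- The cubes of an admissible chain, continued to a sequence that is eventually constant. -/
theorem IsAdmissibleChain.exists_seq {n : ℕ} {c : Fin (n + 1) → DyadicCube d} {j₀ : Fin n}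
    (h : IsAdmissibleChain W ε Q S c j₀) : ∃ e : ℕ → DyadicCube d,
      (∀ j : Fin (n + 1), e j = c j) ∧ (∀ k, e k ∈ W) ∧ (∀ k < n, Neighbors (e k) (e (k + 1))) ∧
        ∑ k ∈ Finset.range (n + 1), (e k).side ≤ 1 / ε * longDist Q S := by
  refine ⟨fun k => c ⟨min k n, by omega⟩, fun j => ?_, fun k => h.mem _, fun k hk => ?_, ?_⟩
  · exact congrArg c (Fin.ext (min_eq_left (Nat.lt_succ_iff.1 j.isLt)))
  · convert h.neighbors ⟨k, hk⟩ using 2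
    · ext
      exact min_eq_left (by omega)
    · ext
      exact min_eq_left (by omega)
  · refine le_trans (le_of_eq ?_) h.length_le
    rw [Finset.sum_range]
    refine Finset.sum_congr rfl fun j _ => ?_
    congr
    exact congrArg c (Fin.ext (min_eq_left (Nat.lt_succ_iff.1 j.isLt)))

/-- For small `ε`, depending on the dimension, the shadow parameter grows like `ε⁻²`: one factor
compares the length of a chain with the long distance of its ends, the other one the long distance
with the central cube. -/
theorem exists_isShadowParameter (d : ℕ) {ε : ℝ} (hε : 0 < ε) :
    ∃ ρ : ℝ, ∀ W : Set (DyadicCube d), IsShadowParameter ε W ρ := by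
  have hd := Real.sqrt_nonneg d
  refine ⟨1 + (1 + √d / ε + 3 * √d * (1 / ε * (2 * (1 + √d) / ε))), fun W => ⟨?_, ?_, ?_⟩⟩
  · have : 0 < 1 + √d / ε + 3 * √d * (1 / ε * (2 * (1 + √d) / ε)) := by positivity
    linarith
  · intro Q S n c j₀ h j hj
    refine ⟨h.first ▸ h.mem 0, fun x hx => ?_⟩
    rw [Metric.mem_ball]
    have h1 := h.ascending j hj
    have h2 := dist_le_longDist hx (c j).center_mem
    have h3 := (c j).side_pos
    have h4 : longDist Q (c j) ≤ (c j).side / ε := by rw [le_div_iff₀ hε]; linarith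
    have h5 : 0 ≤ 3 * √d * (1 / ε * (2 * (1 + √d) / ε)) := by positivity
    calc dist x (c j).center ≤ √d * ((c j).side / ε) := h2.trans (by gcongr)
      _ = √d / ε * (c j).side := by ring
      _ < _ := by gcongr; linarith
  · intro Q S n c j₀ h j
    refine ⟨h.mem j, fun x hx => ?_⟩
    rw [Metric.mem_ball]
    obtain ⟨e, he, -, hne, hsum⟩ := h.exists_seq
    have h1 := h.longDist_le_central hε
    set T := c j₀.castSucc with hT
    have hTpos := T.side_pos
    set σ := ∑ k ∈ Finset.range (n + 1), (e k).side with hσ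
    have hle : ∀ k ≤ n, (e k).side ≤ σ := fun k hk =>
      Finset.single_le_sum (f := fun k => (e k).side) (fun k _ => (e k).side_pos.le)
        (Finset.mem_range.2 (by omega))
    have hcc : ∀ a b, a ≤ b → b ≤ n → dist (e a).center (e b).center ≤ 2 * √d * σ := by
      intro a b hab hb
      calc dist (e a).center (e b).center
          ≤ ∑ k ∈ Finset.Ico a b, √d * ((e k).side + (e (k + 1)).side) := by
            refine dist_le_Ico_sum_of_dist_le (f := fun k => (e k).center) hab ?_
            intro k _ hk
            exact (hne k (by omega)).dist_le (e k).center_mem (e (k + 1)).center_mem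
        _ = √d * (∑ k ∈ Finset.Ico a b, (e k).side + ∑ k ∈ Finset.Ico a b, (e (k + 1)).side) := by
            rw [← Finset.mul_sum, Finset.sum_add_distrib]
        _ ≤ √d * (σ + σ) := by
            gcongr
            · refine Finset.sum_le_sum_of_subset_of_nonneg ?_ fun k _ _ => (e k).side_pos.le
              intro k hk
              simp only [Finset.mem_Ico, Finset.mem_range] at hk ⊢
              omega
            · rw [Finset.sum_Ico_add' (fun k => (e k).side)]
              refine Finset.sum_le_sum_of_subset_of_nonneg ?_ fun k _ _ => (e k).side_pos.le
              intro k hk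
              simp only [Finset.mem_Ico, Finset.mem_range] at hk ⊢
              omega
        _ = _ := by ring
    have hc : dist (c j).center T.center ≤ 2 * √d * σ := by
      rw [hT, ← he, ← he]
      rcases le_total (j : ℕ) (j₀.castSucc : ℕ) with hj | hj
      · exact hcc _ _ hj (by omega)
      · rw [dist_comm]
        exact hcc _ _ hj (by omega)
    have hx' : dist x (c j).center ≤ √d * σ := by
      refine (DyadicCube.dist_le hx (c j).center_mem).trans ?_
      gcongr
      rw [← he]
      exact hle _ (by omega)
    have h5 : 0 ≤ √d / ε := by positivity
    calc dist x T.center ≤ √d * σ + 2 * √d * σ :=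
          (dist_triangle _ (c j).center _).trans (add_le_add hx' hc)
      _ = 3 * √d * σ := by ring
      _ ≤ 3 * √d * (1 / ε * (2 * (1 + √d) / ε * T.side)) := by
          gcongr
          exact hsum.trans (by gcongr)
      _ = 3 * √d * (1 / ε * (2 * (1 + √d) / ε)) * T.side := by ring
      _ < _ := by gcongr; linarith

theorem IsUniformDomainWith.le_half (hΩ : IsUniformDomainWith ε Ω W) (hε : 0 < ε)
    (hQ : Q ∈ W) : ε ≤ 1 / 2 := by
  obtain ⟨n, c, j₀, h⟩ := hΩ.exists_chain Q hQ Q hQ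
  exact h.le_half hε

theorem IsUniformDomainWith.mem_shadowCubes_self (hΩ : IsUniformDomainWith ε Ω W)
    (hρ : IsShadowParameter ε W ρ) (hQ : Q ∈ W) : Q ∈ shadowCubes W ρ Q := by
  obtain ⟨n, c, j₀, h⟩ := hΩ.exists_chain Q hQ Q hQ
  simpa [h.first] using hρ.first_mem Q Q n c j₀ h 0 (Fin.zero_le _)

theorem subset_shadow {P : DyadicCube d} (h : Q ∈ shadowCubes W ρ P) :
    Q.toSet ⊆ shadow W ρ P :=
  subset_biUnion_of_mem (u := fun Q : DyadicCube d => Q.toSet) h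

theorem measurableSet_shadow (P : DyadicCube d) : MeasurableSet (shadow W ρ P) :=
  (isOpen_biUnion fun Q _ => Q.isOpen_toSet).measurableSet

theorem dist_center_lt_of_mem_shadow {P : DyadicCube d} {x : EuclideanSpace ℝ (Fin d)}
    (hx : x ∈ shadow W ρ P) : dist x P.center < ρ * P.side := by
  simp only [shadow, mem_iUnion] at hx
  obtain ⟨Q, hQ, hx⟩ := hx
  exact hQ.2 hx

theorem IsWhitneyCovering.subset (hW : IsWhitneyCovering Ω W) (hQ : Q ∈ W) : Q.toSet ⊆ Ω := by
  rw [← hW.cover]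
  exact subset_closure.trans (subset_biUnion_of_mem (u := fun Q : DyadicCube d => closure Q.toSet) hQ)

theorem IsWhitneyCovering.shadow_subset (hW : IsWhitneyCovering Ω W) (P : DyadicCube d) :
    shadow W ρ P ⊆ Ω :=
  iUnion₂_subset fun _ hQ => hW.subset hQ.1

theorem IsWhitneyCovering.eq_of_mem (hW : IsWhitneyCovering Ω W) (hQ : Q ∈ W) (hS : S ∈ W)
    {x : EuclideanSpace ℝ (Fin d)} (hx : x ∈ Q.toSet) (hx' : x ∈ S.toSet) : Q = S := by
  by_contra h
  exact (hW.disjoint Q hQ S hS h).le_bot ⟨hx, hx'⟩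

theorem IsWhitneyCovering.side_le_two_mul (hW : IsWhitneyCovering Ω W) (hQ : Q ∈ W) (hS : S ∈ W)
    (h : Neighbors Q S) : Q.side ≤ 2 * S.side := by
  by_contra! hlt
  have hs := S.side_pos
  have := hW.side_le Q hQ S hS fun x hx i => by
    have := h.symm.abs_sub_le hx Q.center_mem i
    linarith
  linarith

/-- Points of Whitney cubes that are not neighbors are far from each other. It rests on the
condition on the cubes contained in `5Q`: points close to `Q` lie in cubes that are not small, and
dyadic cubes that are not small have to touch `Q` if they come close to it. -/
theorem IsWhitneyCovering.side_le_dist (hW : IsWhitneyCovering Ω W) (hQ : Q ∈ W) (hS : S ∈ W)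
    (h : ¬ Neighbors Q S) {x y : EuclideanSpace ℝ (Fin d)} (hx : x ∈ Q.toSet) (hy : y ∈ S.toSet) :
    Q.side / 2 ≤ dist x y := by
  by_contra! hlt
  apply h
  have hc : ∀ i, |x i - y i| < Q.side / 2 := fun i => (abs_sub_apply_le_dist x y i).trans_lt hlt
  have hQp := Q.side_pos
  have hS2 : Q.scale - 1 ≤ S.scale := by
    have : Q.side / 2 ≤ S.side := by
      rcases le_total S.side Q.side with hle | hle
      · refine hW.side_le Q hQ S hS fun z hz i => ?_
        have h1 := abs_lt.1 (DyadicCube.abs_sub_lt_side hz hy i)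
        have h2 := abs_lt.1 (hc i)
        have h3 := abs_lt.1 (DyadicCube.abs_sub_center_lt hx i)
        rw [abs_lt]
        constructor <;> linarith
      · linarith
    have h2 : (⟨Q.scale - 1, Q.index⟩ : DyadicCube d).side ≤ S.side := by
      refine le_trans (le_of_eq ?_) this
      simp [DyadicCube.side, zpow_sub_one₀, div_eq_mul_inv]
    exact DyadicCube.side_le_side_iff.1 h2
  obtain ⟨j, hj⟩ : ∃ j : ℕ, (Q.scale - 1) + j = S.scale := ⟨(S.scale - (Q.scale - 1)).toNat, by omega⟩
  -- All endpoints are integer multiples of half of the side length of `Q`.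
  set u : ℝ := Q.side / 2 with hu
  have hQs : Q.side = 2 * u := by rw [hu]; ring
  have hSs : S.side = 2 ^ j * u := by
    have := DyadicCube.side_eq_pow_mul (Q := (⟨Q.scale - 1, Q.index⟩ : DyadicCube d)) hj
    rw [this]
    simp [DyadicCube.side, zpow_sub_one₀, div_eq_mul_inv, hu]
  have hup : 0 < u := by positivity
  rw [neighbors_iff]
  intro i
  have h1 := abs_lt.1 (hc i)
  have h2 := hx i
  have h3 := hy i
  rw [hQs, hSs] at *
  have h4 : (2 : ℝ) * Q.index i < 2 ^ j * (S.index i + 1) + 1 := by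
    refine lt_of_mul_lt_mul_left (a := u) ?_ hup.le
    linarith
  have h5 : (2 : ℝ) ^ j * S.index i < 2 * (Q.index i + 1) + 1 := by
    refine lt_of_mul_lt_mul_left (a := u) ?_ hup.le
    linarith
  have h6 : (2 : ℝ) * Q.index i ≤ 2 ^ j * (S.index i + 1) := by
    exact_mod_cast Int.lt_add_one_iff.1 (by exact_mod_cast h4)
  have h7 : (2 : ℝ) ^ j * S.index i ≤ 2 * (Q.index i + 1) := by
    exact_mod_cast Int.lt_add_one_iff.1 (by exact_mod_cast h5)
  constructor <;> nlinarith

theorem IsWhitneyCovering.longDist_le_dist (hW : IsWhitneyCovering Ω W) (hQ : Q ∈ W) (hS : S ∈ W)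
    (h : ¬ Neighbors Q S) {x y : EuclideanSpace ℝ (Fin d)} (hx : x ∈ Q.toSet) (hy : y ∈ S.toSet) :
    longDist Q S ≤ 5 * dist x y := by
  have h1 := hW.side_le_dist hQ hS h hx hy
  have h2 := hW.side_le_dist hS hQ (fun h' => h h'.symm) hy hx
  rw [dist_comm] at h2
  have h3 := longDist_le hx hy
  linarith

/-- A neighbor that is not larger lies in the shadow, since two neighbors form an admissible chain
whose central cube is the larger one. -/
theorem IsUniformDomainWith.neighbor_mem_shadowCubes (hΩ : IsUniformDomainWith ε Ω W)
    (hε : 0 < ε) (hρ : IsShadowParameter ε W ρ) (hQ : Q ∈ W) (hS : S ∈ W) (h : Neighbors Q S)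
    (hle : S.side ≤ Q.side) : S ∈ shadowCubes W ρ Q := by
  have hε2 := hΩ.le_half hε hQ
  have hQp := Q.side_pos
  have hSp := S.side_pos
  have hdist : setEDist Q.toSet S.toSet = 0 := by
    obtain ⟨z, hz1, hz2⟩ := h
    refine nonpos_iff_eq_zero.1 (ENNReal.le_of_forall_pos_le_add fun δ hδ _ => ?_)
    rw [EMetric.mem_closure_iff] at hz1 hz2
    obtain ⟨a, ha, ha'⟩ := hz1 (δ / 2) (by simpa using hδ.ne')
    obtain ⟨b, hb, hb'⟩ := hz2 (δ / 2) (by simpa using hδ.ne')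
    rw [zero_add]
    calc setEDist Q.toSet S.toSet ≤ edist a b := (iInf₂_le _ ha).trans (iInf₂_le _ hb)
      _ ≤ edist z a + edist z b := edist_triangle_left _ _ _
      _ ≤ δ / 2 + δ / 2 := add_le_add ha'.le hb'.le
      _ = δ := ENNReal.add_halves _
  have hD : longDist Q S = Q.side + S.side := by simp [longDist, hdist]
  have hchain : IsAdmissibleChain W ε Q S (n := 1) ![Q, S] 0 :=
    { mem := fun j => by fin_cases j <;> assumption
      first := rfl
      last := rfl
      neighbors := fun j => by
        obtain rfl : j = 0 := Subsingleton.elim _ _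
        exact h
      length_le := by
        rw [show ∑ j, ((![Q, S] : Fin 2 → DyadicCube d) j).side = Q.side + S.side from
          Fin.sum_univ_two _]
        rw [hD, div_mul_eq_mul_div, le_div_iff₀ hε]
        nlinarith
      ascending := fun j hj => by
        obtain rfl : j = 0 := by simpa using hj
        have := longDist_self_le Q
        change ε * longDist Q Q ≤ Q.side
        nlinarith
      descending := fun j _ => by
        fin_cases j
        · change ε * longDist Q S ≤ Q.side
          rw [hD]
          nlinarith
        · change ε * longDist S S ≤ S.side
          have := longDist_self_le S
          nlinarith }
  exact hρ.mem_central Q S 1 ![Q, S] 0 hchain 1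

end Chains

/-! ### Porosity and packing of Whitney cubes -/

/-- In a uniform domain, every dyadic cube `R` of `ℝ^d` has a descendant of a fixed generation that
contains no Whitney cube. If two prescribed small descendants both contain Whitney cubes, then an
admissible chain between these grows to size comparable to `ℓ(R)`, and it does so before it
leaves `R`; the empty descendant is then found inside a cube of the chain. -/
theorem exists_descendant_forall_not_mem (hd : 1 ≤ d) {ε : ℝ} (hε : 0 < ε) :
    ∃ m : ℕ, 1 ≤ m ∧ ∀ (Ω : Set (EuclideanSpace ℝ (Fin d))) (W : Set (DyadicCube d)),
      IsUniformDomainWith ε Ω W → ∀ R : DyadicCube d, ∃ R' : DyadicCube d,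
        DyadicCube.IsDescendant m R' R ∧ ∀ Q ∈ W, ∀ j, ¬ DyadicCube.IsDescendant j Q R' := by
  have hsd := Real.sqrt_nonneg d
  -- The size `2 ^ (-m) * ℓ(R)` is so small that the central cube of a chain whose ends are at distance
  -- `ℓ(R) / 4` is larger, and that the chain stays near its first cube until it exceeds this size.
  obtain ⟨m, hm⟩ := pow_unbounded_of_one_lt (16 * (1 + √d) / ε + 4) one_lt_two
  have hm4 : (4 : ℝ) ≤ 2 ^ m := by
    have : 0 ≤ 16 * (1 + √d) / ε := by positivity
    linarith
  have hm16 : 16 * (1 + √d) ≤ 2 ^ m * ε := by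
    rw [← div_le_iff₀ hε]
    linarith
  have hm2 : 2 ≤ m := by
    by_contra! h
    have : (2 : ℝ) ^ m ≤ 2 ^ 1 := pow_le_pow_right₀ one_le_two (by omega)
    linarith
  refine ⟨m, by omega, fun Ω W hΩ R => ?_⟩
  have hmm : m = 2 + (m - 2) := by omega
  have h1 : DyadicCube.IsDescendant 2 (R.descendant 2 1) R :=
    R.isDescendant_descendant (by norm_num) (by norm_num)
  have h3 : DyadicCube.IsDescendant 2 (R.descendant 2 3) R :=
    R.isDescendant_descendant (by norm_num) (by norm_num)
  set R₁ := (R.descendant 2 1).descendant (m - 2) 0 with hR₁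
  set R₂ := (R.descendant 2 3).descendant (m - 2) 0 with hR₂
  have h1' : DyadicCube.IsDescendant (m - 2) R₁ (R.descendant 2 1) :=
    DyadicCube.isDescendant_descendant le_rfl (by positivity) _
  have h3' : DyadicCube.IsDescendant (m - 2) R₂ (R.descendant 2 3) :=
    DyadicCube.isDescendant_descendant le_rfl (by positivity) _
  have h1R : DyadicCube.IsDescendant m R₁ R := by rw [hmm]; exact h1'.trans h1
  have h3R : DyadicCube.IsDescendant m R₂ R := by rw [hmm]; exact h3'.trans h3
  by_cases hc1 : ∀ Q ∈ W, ∀ j, ¬ DyadicCube.IsDescendant j Q R₁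
  · exact ⟨R₁, h1R, hc1⟩
  by_cases hc2 : ∀ Q ∈ W, ∀ j, ¬ DyadicCube.IsDescendant j Q R₂
  · exact ⟨R₂, h3R, hc2⟩
  push Not at hc1 hc2
  obtain ⟨Q, hQ, jQ, hQR⟩ := hc1
  obtain ⟨S, hS, jS, hSR⟩ := hc2
  have hRpos := R.side_pos
  have hu := R₁.side_pos
  have hRu : R.side = 2 ^ m * R₁.side := DyadicCube.side_eq_pow_mul h1R.1
  have hQu : Q.side ≤ R₁.side := by
    rw [DyadicCube.side_le_side_iff]
    have := hQR.1
    omega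
  have hR4 : (R.descendant 2 1).side = R.side / 4 := by
    have := DyadicCube.side_eq_pow_mul h1.1
    linarith
  have hR4' : (R.descendant 2 3).side = R.side / 4 := by
    have := DyadicCube.side_eq_pow_mul h3.1
    linarith
  have hx : ∀ i, R.side * (R.index i + 1 / 4) < Q.center i ∧
      Q.center i < R.side * (R.index i + 1 / 2) := by
    intro i
    have := h1'.subset (hQR.subset Q.center_mem) i
    rw [hR4] at this
    simp only [DyadicCube.descendant] at this
    push_cast at this
    constructor <;> linarith
  have hy : ∀ i, R.side * (R.index i + 3 / 4) < S.center i := by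
    intro i
    have := h3'.subset (hSR.subset S.center_mem) i
    rw [hR4'] at this
    simp only [DyadicCube.descendant] at this
    push_cast at this
    linarith
  have hD : R.side / 4 ≤ longDist Q S := by
    have h := (abs_le.1 (abs_sub_le_longDist Q.center_mem S.center_mem ⟨0, hd⟩)).1
    have h2 := hx ⟨0, hd⟩
    have h3 := hy ⟨0, hd⟩
    linarith
  obtain ⟨n, c, j₀, hch⟩ := hΩ.exists_chain Q hQ S hS
  obtain ⟨e, he, heW, hne, -⟩ := hch.exists_seq
  have hcen : 2 * R₁.side ≤ (e (j₀.castSucc : Fin (n + 1))).side := by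
    rw [he]
    have h := hch.longDist_le_central hε
    rw [div_mul_eq_mul_div, le_div_iff₀ hε] at h
    have h5 : 16 * (1 + √d) * R₁.side ≤ 8 * (1 + √d) * (c j₀.castSucc).side := by
      calc 16 * (1 + √d) * R₁.side ≤ 2 ^ m * ε * R₁.side := by gcongr
        _ = R.side * ε := by rw [hRu]; ring
        _ ≤ _ := by nlinarith
    have h6 : 0 < 8 * (1 + √d) := by positivity
    refine le_of_mul_le_mul_left ?_ h6
    linarith
  have hex : ∃ k, 2 * R₁.side ≤ (e k).side := ⟨_, hcen⟩
  classical
  obtain ⟨k, hk, hmin⟩ : ∃ k, 2 * R₁.side ≤ (e k).side ∧ ∀ l < k, (e l).side < 2 * R₁.side :=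
    ⟨Nat.find hex, Nat.find_spec hex, fun l hl => not_le.1 (Nat.find_min hex hl)⟩
  have hkj : k ≤ (j₀.castSucc : Fin (n + 1)) := by
    by_contra! h
    linarith [hmin _ h]
  have hk0 : k ≠ 0 := by
    rintro rfl
    have h0 : e 0 = Q := by rw [← hch.first]; exact he 0
    rw [h0] at hk
    linarith
  have hk4 : (e k).side < 4 * R₁.side := by
    obtain ⟨l, rfl⟩ := Nat.exists_eq_succ_of_ne_zero hk0
    have hln : l < n := by
      have := j₀.isLt
      simp only [Fin.val_castSucc] at hkj
      omega
    have h5 := hΩ.whitney.side_le_two_mul (heW _) (heW _) (hne l hln).symm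
    have h6 := hmin l (Nat.lt_succ_self l)
    have h7 : (e (l + 1)).side ≤ 2 * (e l).side := h5
    rw [Nat.succ_eq_add_one]
    linarith
  set U := e k with hU
  have hDU : longDist Q U ≤ R.side / 4 := by
    have hkn : k < n + 1 := lt_of_le_of_lt hkj (Fin.isLt _)
    have hek : U = c ⟨k, hkn⟩ := he ⟨k, hkn⟩
    have h5 := hch.ascending ⟨k, hkn⟩ hkj
    rw [← hek] at h5
    have h6 : 16 * R₁.side ≤ R.side * ε := by
      rw [hRu]
      nlinarith
    refine le_of_mul_le_mul_left (a := ε) ?_ hε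
    linarith
  have hUR : U.center ∈ R.toSet := by
    intro i
    have h5 := abs_le.1 (abs_sub_le_longDist Q.center_mem U.center_mem i)
    have h6 := hx i
    constructor <;> nlinarith
  have hUs : U.side ≤ R.side := by
    rw [hRu]
    nlinarith
  have hUsub := DyadicCube.subset_of_mem hUs U.center_mem hUR
  have hscale : R₁.scale < U.scale := by
    by_contra! h
    have := DyadicCube.side_le_side_iff.2 h
    linarith
  obtain ⟨l, hl⟩ : ∃ l : ℕ, U.scale = R₁.scale + l := ⟨(U.scale - R₁.scale).toNat, by omega⟩
  have hdU : DyadicCube.IsDescendant l (U.descendant l 0) U :=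
    DyadicCube.isDescendant_descendant le_rfl (by positivity) _
  refine ⟨U.descendant l 0, ?_, ?_⟩
  · refine DyadicCube.isDescendant_of_mem ?_ (DyadicCube.center_mem _)
      (hUsub (hdU.subset (DyadicCube.center_mem _)))
    have := hdU.1
    have := h1R.1
    omega
  · intro T hT j hTj
    have hTU : T = U := hΩ.whitney.eq_of_mem hT (heW k) T.center_mem
      (hdU.subset (hTj.subset T.center_mem))
    have h5 := hTj.1
    have h6 := hdU.1
    rw [hTU] at h5
    omega

namespace DyadicCube

theorem mk_injective (k : ℤ) : Function.Injective (DyadicCube.mk (d := d) k) :=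
  fun v w h => by simpa using h

/-- The finite set of descendants of `R` of generation `j`. -/
noncomputable def descendants (j : ℕ) (R : DyadicCube d) : Finset (DyadicCube d) :=
  (Fintype.piFinset fun i => Finset.Ico (2 ^ j * R.index i) (2 ^ j * (R.index i + 1))).map
    ⟨DyadicCube.mk (R.scale - j), mk_injective _⟩

theorem mem_descendants {j : ℕ} {Q R : DyadicCube d} :
    Q ∈ descendants j R ↔ IsDescendant j Q R := by
  simp only [descendants, Finset.mem_map, Fintype.mem_piFinset, Finset.mem_Ico,
    Function.Embedding.coeFn_mk, IsDescendant]
  constructor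
  · rintro ⟨v, hv, rfl⟩
    exact ⟨by simp, hv⟩
  · rintro ⟨h1, h2⟩
    refine ⟨Q.index, h2, ?_⟩
    rw [← h1]
    simp

theorem card_descendants (j : ℕ) (R : DyadicCube d) : (descendants j R).card = (2 ^ j) ^ d := by
  rw [descendants, Finset.card_map, Fintype.card_piFinset]
  have : ∀ i, (Finset.Ico (2 ^ j * R.index i) (2 ^ j * (R.index i + 1))).card = 2 ^ j := by
    intro i
    rw [Int.card_Ico, mul_add, add_sub_cancel_left, mul_one]
    have : (2 : ℤ) ^ j = ((2 ^ j : ℕ) : ℤ) := by push_cast; rfl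
    rw [this, Int.toNat_natCast]
  simp [this]

end DyadicCube

open Classical in
/-- The number of Whitney cubes of generation `j` in a dyadic cube grows at a smaller rate than the
number of all subcubes, namely as if the boundary had dimension `d - κ`. This follows from
porosity by iteration. -/
theorem exists_card_descendants_le (hd : 1 ≤ d) {ε : ℝ} (hε : 0 < ε) :
    ∃ (κ : ℝ) (C : ℝ≥0), 0 < κ ∧ ∀ (Ω : Set (EuclideanSpace ℝ (Fin d))) (W : Set (DyadicCube d)),
      IsUniformDomainWith ε Ω W → ∀ (j : ℕ) (R : DyadicCube d),
        (((DyadicCube.descendants j R).filter (· ∈ W)).card : ℝ≥0∞) ≤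
          C * 2 ^ ((d - κ) * j : ℝ) := by
  obtain ⟨m, hm, H⟩ := exists_descendant_forall_not_mem hd hε
  have hmpos : (0 : ℝ) < m := by exact_mod_cast hm
  have hNd : 1 < (2 ^ m) ^ d := Nat.one_lt_pow (by omega) (Nat.one_lt_pow (by omega) (by omega))
  set N : ℕ := (2 ^ m) ^ d with hN
  have hNr : (1 : ℝ) < N := by exact_mod_cast hNd
  -- `κ` is chosen such that `2 ^ (m * (d - κ)) = 2 ^ (m * d) - 1`.
  set κ : ℝ := -Real.logb 2 (1 - 1 / N) / m with hκ
  have h01 : 0 < 1 - 1 / (N : ℝ) := by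
    rw [sub_pos, div_lt_one (by linarith)]
    exact hNr
  have hκpos : 0 < κ := by
    have : Real.logb 2 (1 - 1 / N) < 0 := Real.logb_neg one_lt_two h01 (by
      have : (0 : ℝ) < 1 / N := by positivity
      linarith)
    rw [hκ]
    exact div_pos (by linarith) hmpos
  have hstep : ((N - 1 : ℕ) : ℝ≥0∞) = 2 ^ ((d - κ) * m : ℝ) := by
    have h1 : (2 : ℝ) ^ ((d - κ) * m : ℝ) = ((N - 1 : ℕ) : ℝ) := by
      rw [sub_mul, hκ, div_mul_cancel₀ _ hmpos.ne', sub_neg_eq_add, Real.rpow_add two_pos,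
        Real.rpow_logb two_pos (by norm_num) h01, Nat.cast_sub hNd.le, mul_comm (d : ℝ),
        Real.rpow_mul two_pos.le, Real.rpow_natCast, Real.rpow_natCast, hN]
      push_cast
      field_simp
    have h2 := congrArg ENNReal.ofReal h1
    rw [← ENNReal.ofReal_rpow_of_pos two_pos, ENNReal.ofReal_natCast] at h2
    simpa using h2.symm
  have hC : ((2 : ℝ≥0) ^ (κ * m) : ℝ≥0) = ((2 : ℝ≥0∞) ^ (κ * m) : ℝ≥0∞) := by
    rw [ENNReal.coe_rpow_of_ne_zero two_ne_zero]
    simp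
  refine ⟨κ, 2 ^ (κ * m), hκpos, fun Ω W hΩ j => ?_⟩
  rw [hC]
  induction j using Nat.strong_induction_on with
  | _ j ih =>
    intro R
    rcases lt_or_ge j m with hj | hj
    · calc (((DyadicCube.descendants j R).filter (· ∈ W)).card : ℝ≥0∞)
          ≤ ((2 ^ j) ^ d : ℕ) := by
            rw [← DyadicCube.card_descendants j R]
            exact_mod_cast Finset.card_filter_le _ _
        _ = 2 ^ (j * d : ℝ) := by
            rw [ENNReal.rpow_mul, ENNReal.rpow_natCast, ENNReal.rpow_natCast]
            push_cast
            rfl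
        _ ≤ 2 ^ (κ * m + (d - κ) * j : ℝ) := by
            refine ENNReal.rpow_le_rpow_of_exponent_le one_le_two ?_
            have : (j : ℝ) ≤ m := by exact_mod_cast hj.le
            nlinarith
        _ = _ := ENNReal.rpow_add _ _ two_ne_zero ENNReal.ofNat_ne_top
    · obtain ⟨l, rfl⟩ := Nat.exists_eq_add_of_le hj
      obtain ⟨R', hR', hempty⟩ := H Ω W hΩ R
      have hsub : (DyadicCube.descendants (m + l) R).filter (· ∈ W) ⊆
          ((DyadicCube.descendants m R).erase R').biUnion
            fun T => (DyadicCube.descendants l T).filter (· ∈ W) := by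
        intro Q hQ
        rw [Finset.mem_filter, DyadicCube.mem_descendants] at hQ
        have hA := DyadicCube.isDescendant_ancestor l Q
        simp only [Finset.mem_biUnion, Finset.mem_filter, Finset.mem_erase,
          DyadicCube.mem_descendants]
        refine ⟨Q.ancestor l, ⟨?_, ?_⟩, hA, hQ.2⟩
        · rintro rfl
          exact hempty Q hQ.2 l hA
        · refine DyadicCube.isDescendant_of_mem ?_ (hA.subset Q.center_mem)
            (hQ.1.subset Q.center_mem)
          have h1 := hA.1
          have h2 := hQ.1.1
          push_cast at h2
          omega
      calc (((DyadicCube.descendants (m + l) R).filter (· ∈ W)).card : ℝ≥0∞)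
          ≤ ∑ T ∈ (DyadicCube.descendants m R).erase R',
              (((DyadicCube.descendants l T).filter (· ∈ W)).card : ℝ≥0∞) := by
            exact_mod_cast (Finset.card_le_card hsub).trans Finset.card_biUnion_le
        _ ≤ ∑ T ∈ (DyadicCube.descendants m R).erase R',
              (2 ^ (κ * m : ℝ) * 2 ^ ((d - κ) * l : ℝ) : ℝ≥0∞) :=
            Finset.sum_le_sum fun T _ => ih l (by omega) T
        _ = ((N - 1 : ℕ) : ℝ≥0∞) * (2 ^ (κ * m : ℝ) * 2 ^ ((d - κ) * l : ℝ)) := by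
            rw [Finset.sum_const, Finset.card_erase_of_mem (DyadicCube.mem_descendants.2 hR'),
              DyadicCube.card_descendants, nsmul_eq_mul]
        _ = 2 ^ (κ * m : ℝ) * (2 ^ ((d - κ) * m : ℝ) * 2 ^ ((d - κ) * l : ℝ)) := by
            rw [hstep]
            ring
        _ = _ := by
            rw [← ENNReal.rpow_add _ _ two_ne_zero ENNReal.ofNat_ne_top]
            push_cast
            ring_nf

/-! ### Sums over shadows -/

open Classical in
theorem tsum_ite_mem_le {ι α : Type*} {φ : ι → α} (hφ : φ.Injective) (F : Finset α) (g : ℝ≥0∞) :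
    ∑' i, (if φ i ∈ F then g else 0) ≤ F.card * g := by
  calc ∑' i, (if φ i ∈ F then g else 0) ≤ ∑' a, (if a ∈ F then g else 0) :=
        ENNReal.tsum_comp_le_tsum_of_injective hφ _
    _ = ∑ a ∈ F, (if a ∈ F then g else 0) := tsum_eq_sum fun a ha => if_neg ha
    _ = F.card * g := by
        rw [Finset.sum_congr rfl fun a ha => if_pos ha, Finset.sum_const, nsmul_eq_mul]

/-- A sum is estimated by splitting its nonzero terms into finite layers. -/
theorem tsum_le_tsum_card_mul {ι α : Type*} {φ : ι → α} (hφ : φ.Injective) (w : ι → ℝ≥0∞)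
    (F : ℕ → Finset α) (g : ℕ → ℝ≥0∞) (h : ∀ i, w i ≠ 0 → ∃ j, φ i ∈ F j ∧ w i ≤ g j) :
    ∑' i, w i ≤ ∑' j, (F j).card * g j := by
  classical
  calc ∑' i, w i ≤ ∑' i, ∑' j, (if φ i ∈ F j then g j else 0) := by
        refine ENNReal.tsum_le_tsum fun i => ?_
        by_cases hi : w i = 0
        · simp [hi]
        · obtain ⟨j, hj, hle⟩ := h i hi
          refine hle.trans ?_
          refine le_trans ?_ (ENNReal.le_tsum j)
          simp [hj]
    _ = ∑' j, ∑' i, (if φ i ∈ F j then g j else 0) := ENNReal.tsum_comm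
    _ ≤ _ := ENNReal.tsum_le_tsum fun j => tsum_ite_mem_le hφ _ _

theorem tsum_two_rpow_neg_ne_top {a : ℝ} (ha : 0 < a) :
    ∑' j : ℕ, (2 : ℝ≥0∞) ^ (-(a * j)) ≠ ∞ := by
  have h : ∀ j : ℕ, (2 : ℝ≥0∞) ^ (-(a * j)) = ((2 : ℝ≥0∞) ^ (-a)) ^ j := fun j => by
    rw [← ENNReal.rpow_natCast, ← ENNReal.rpow_mul, neg_mul]
  simp_rw [h, ENNReal.tsum_geometric]
  have : (2 : ℝ≥0∞) ^ (-a) < 1 := ENNReal.rpow_lt_one_of_one_lt_of_neg ENNReal.one_lt_two (by linarith)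
  exact ENNReal.inv_ne_top.2 (tsub_pos_of_lt this).ne'

theorem tsum_mul_le_rpow {ι : Type*} {p : ℝ} (hp : 1 ≤ p) (w f : ι → ℝ≥0∞) :
    (∑' i, w i * f i) ^ p ≤ (∑' i, w i) ^ (p - 1) * ∑' i, w i * f i ^ p := by
  have hp0 : 0 < p := by linarith
  have hexp : 0 ≤ 1 - p⁻¹ := by
    rw [sub_nonneg]
    exact inv_le_one_of_one_le₀ hp
  have h : ∑' i, w i * f i ≤ (∑' i, w i) ^ (1 - p⁻¹) * (∑' i, w i * f i ^ p) ^ p⁻¹ := by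
    rw [ENNReal.tsum_eq_iSup_sum]
    refine iSup_le fun s => (ENNReal.inner_le_weight_mul_Lp_of_nonneg s hp w f).trans ?_
    gcongr
    · exact ENNReal.sum_le_tsum s
    · exact ENNReal.sum_le_tsum s
  calc (∑' i, w i * f i) ^ p ≤ ((∑' i, w i) ^ (1 - p⁻¹) * (∑' i, w i * f i ^ p) ^ p⁻¹) ^ p := by
        gcongr
    _ = _ := by
        rw [ENNReal.mul_rpow_of_nonneg _ _ hp0.le, ← ENNReal.rpow_mul, ← ENNReal.rpow_mul,
          inv_mul_cancel₀ hp0.ne', ENNReal.rpow_one, sub_mul, one_mul, inv_mul_cancel₀ hp0.ne']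

/-- The number of dyadic cubes of a given size that are close to a given point is bounded. -/
theorem exists_card_near_le (d : ℕ) (r : ℝ) : ∃ M : ℕ, ∀ (k : ℤ) (z : EuclideanSpace ℝ (Fin d)),
    ∃ F : Finset (DyadicCube d), F.card ≤ M ∧
      ∀ P : DyadicCube d, P.scale = k → (∀ i, |P.center i - z i| ≤ r * P.side) → P ∈ F := by
  refine ⟨⌈2 * r + 1⌉₊ ^ d, fun k z => ?_⟩
  set a : Fin d → ℝ := fun i => z i / 2 ^ k - 1 / 2 - r with ha
  set b : Fin d → ℝ := fun i => z i / 2 ^ k - 1 / 2 + r with hb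
  refine ⟨(Fintype.piFinset fun i => Finset.Icc ⌈a i⌉ ⌊b i⌋).map
    ⟨DyadicCube.mk k, DyadicCube.mk_injective k⟩, ?_, ?_⟩
  · rw [Finset.card_map, Fintype.card_piFinset]
    calc ∏ i, (Finset.Icc ⌈a i⌉ ⌊b i⌋).card ≤ ∏ _i : Fin d, ⌈2 * r + 1⌉₊ := by
          refine Finset.prod_le_prod' fun i _ => ?_
          rw [Int.card_Icc, Int.toNat_le]
          have h1 : (⌊b i⌋ : ℝ) ≤ b i := Int.floor_le _
          have h2 : a i ≤ ⌈a i⌉ := Int.le_ceil _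
          have h3 : 2 * r + 1 ≤ ⌈2 * r + 1⌉₊ := Nat.le_ceil _
          have h4 : b i - a i = 2 * r := by simp only [ha, hb]; ring
          have : ((⌊b i⌋ + 1 - ⌈a i⌉ : ℤ) : ℝ) ≤ ((⌈2 * r + 1⌉₊ : ℤ) : ℝ) := by
            push_cast
            linarith
          exact_mod_cast this
      _ = _ := by simp
  · rintro ⟨k', v⟩ rfl h
    refine Finset.mem_map.2 ⟨v, ?_, rfl⟩
    rw [Fintype.mem_piFinset]
    intro i
    have hs := DyadicCube.side_pos ⟨k', v⟩
    have h1 := abs_le.1 (h i)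
    rw [DyadicCube.center_apply] at h1
    have h2 : z i = (⟨k', v⟩ : DyadicCube d).side * (z i / 2 ^ k') := by
      rw [DyadicCube.side, mul_div_cancel₀]
      positivity
    rw [h2] at h1
    simp only at h1
    rw [Finset.mem_Icc, Int.ceil_le, Int.le_floor]
    constructor
    · refine le_of_mul_le_mul_left ?_ hs
      simp only [ha]
      linarith
    · refine le_of_mul_le_mul_left ?_ hs
      simp only [hb]
      linarith

theorem dist_center_lt_of_mem_shadowCubes {W : Set (DyadicCube d)} {ρ : ℝ} {Q P : DyadicCube d}
    (h : Q ∈ shadowCubes W ρ P) : dist Q.center P.center < ρ * P.side :=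
  h.2 Q.center_mem

theorem exists_scale_le_of_mem_shadowCubes (hd : 1 ≤ d) (ρ : ℝ) : ∃ k : ℕ, 8 * ρ ≤ 2 ^ k ∧
    ∀ (W : Set (DyadicCube d)) (Q P : DyadicCube d), Q ∈ shadowCubes W ρ P →
      Q.scale ≤ P.scale + k := by
  obtain ⟨k, hk⟩ := pow_unbounded_of_one_lt (8 * ρ) one_lt_two
  refine ⟨k, hk.le, fun W Q P h => ?_⟩
  have hQ := Q.side_pos
  have hP := P.side_pos
  set z : EuclideanSpace ℝ (Fin d) := WithLp.toLp 2 fun i => Q.side * ((Q.index i : ℝ) + 1 / 4)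
  have hz : z ∈ Q.toSet := fun i => by
    change _ < Q.side * ((Q.index i : ℝ) + 1 / 4) ∧ Q.side * ((Q.index i : ℝ) + 1 / 4) < _
    constructor <;> nlinarith
  have h1 : dist z P.center < ρ * P.side := h.2 hz
  have h2 := dist_center_lt_of_mem_shadowCubes h
  have h3 := abs_sub_apply_le_dist Q.center z ⟨0, hd⟩
  have h4 := dist_triangle_right Q.center z P.center
  have h5 : Q.center ⟨0, hd⟩ - z ⟨0, hd⟩ = Q.side / 4 := by
    rw [DyadicCube.center_apply]
    change _ - Q.side * ((Q.index ⟨0, hd⟩ : ℝ) + 1 / 4) = _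
    ring
  rw [h5, abs_of_pos (by positivity)] at h3
  have h6 : Q.side ≤ (⟨P.scale + k, P.index⟩ : DyadicCube d).side := by
    rw [DyadicCube.side_eq_pow_mul (Q := P) (R := ⟨P.scale + k, P.index⟩) (j := k) rfl]
    nlinarith
  exact DyadicCube.side_le_side_iff.1 h6

open Classical in
/-- The cubes whose shadow contains a given cube are boundedly many in each size, so that a sum over
them of a negative power of their side lengths is dominated by its first terms. -/
theorem exists_tsum_ancestors_le (hd : 1 ≤ d) (ρ : ℝ) {η : ℝ} (hη : 0 < η) :
    ∃ C : ℝ≥0, ∀ (W : Set (DyadicCube d)) (Q : DyadicCube d),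
      ∑' P : W, (if Q ∈ shadowCubes W ρ P then
        (2 : ℝ≥0∞) ^ (-(η * (P.1.scale - Q.scale)) : ℝ) else 0) ≤ C := by
  obtain ⟨k, -, hk⟩ := exists_scale_le_of_mem_shadowCubes hd ρ
  obtain ⟨M, hM⟩ := exists_card_near_le d ρ
  have hne : (M : ℝ≥0∞) * (2 ^ (η * k : ℝ) * ∑' j : ℕ, (2 : ℝ≥0∞) ^ (-(η * j))) ≠ ∞ :=
    ENNReal.mul_ne_top (ENNReal.natCast_ne_top M) (ENNReal.mul_ne_top
      (ENNReal.rpow_ne_top_of_nonneg (by positivity) ENNReal.ofNat_ne_top)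
      (tsum_two_rpow_neg_ne_top hη))
  refine ⟨_, fun W Q => le_trans ?_ (ENNReal.coe_toNNReal hne).ge⟩
  choose F hF hFmem using fun j : ℕ => hM (Q.scale - k + j) Q.center
  refine (tsum_le_tsum_card_mul (φ := ((↑) : W → DyadicCube d)) Subtype.val_injective _ F
    (fun j => 2 ^ (η * k : ℝ) * 2 ^ (-(η * j))) ?_).trans ?_
  · intro P hP
    have hQP : Q ∈ shadowCubes W ρ P := by
      by_contra h
      exact hP (if_neg h)
    have h1 := hk W Q P hQP
    obtain ⟨j, hj⟩ : ∃ j : ℕ, P.1.scale = Q.scale - k + j :=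
      ⟨(P.1.scale - (Q.scale - k)).toNat, by omega⟩
    refine ⟨j, hFmem j P hj fun i => ?_, ?_⟩
    · have := dist_center_lt_of_mem_shadowCubes hQP
      rw [dist_comm] at this
      exact (abs_sub_apply_le_dist _ _ i).trans this.le
    · rw [if_pos hQP, ← ENNReal.rpow_add _ _ two_ne_zero ENNReal.ofNat_ne_top, hj]
      push_cast
      refine le_of_eq ?_
      ring_nf
  · rw [← ENNReal.tsum_mul_left, ← ENNReal.tsum_mul_left]
    refine ENNReal.tsum_le_tsum fun j => ?_
    gcongr
    exact hF j

open Classical in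
/-- The cubes in a shadow satisfy a packing condition with an exponent smaller than `d`. -/
theorem exists_tsum_shadow_le (hd : 1 ≤ d) {ε : ℝ} (hε : 0 < ε) :
    ∃ κ : ℝ, 0 < κ ∧ ∀ κ' < κ, ∀ ρ : ℝ, ∃ C : ℝ≥0,
      ∀ (Ω : Set (EuclideanSpace ℝ (Fin d))) (W : Set (DyadicCube d)), IsUniformDomainWith ε Ω W →
        ∀ P : DyadicCube d, ∑' Q : W, (if Q.1 ∈ shadowCubes W ρ P then
          (2 : ℝ≥0∞) ^ ((d - κ') * (Q.1.scale - P.scale) : ℝ) else 0) ≤ C := by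
  obtain ⟨κ, C₀, hκ, hC₀⟩ := exists_card_descendants_le hd hε
  refine ⟨κ, hκ, fun κ' hκ' ρ => ?_⟩
  obtain ⟨k, hkρ, hk⟩ := exists_scale_le_of_mem_shadowCubes hd ρ
  obtain ⟨M, hM⟩ := exists_card_near_le d 1
  have hne : (M : ℝ≥0∞) * (C₀ * (2 ^ (k * (d - κ') : ℝ) *
      ∑' j : ℕ, (2 : ℝ≥0∞) ^ (-((κ - κ') * j)))) ≠ ∞ :=
    ENNReal.mul_ne_top (ENNReal.natCast_ne_top M) (ENNReal.mul_ne_top ENNReal.coe_ne_top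
      (ENNReal.mul_ne_top (by simp [ENNReal.rpow_eq_top_iff])
      (tsum_two_rpow_neg_ne_top (by linarith))))
  refine ⟨_, fun Ω W hΩ P => le_trans ?_ (ENNReal.coe_toNNReal hne).ge⟩
  -- Every cube of the shadow has an ancestor of side length `2 ^ k * ℓ(P)`, which is close to `P`.
  obtain ⟨F, hF, hFmem⟩ := hM (P.scale + k) P.center
  refine (tsum_le_tsum_card_mul (φ := ((↑) : W → DyadicCube d)) Subtype.val_injective _
    (fun j => F.biUnion fun R => (DyadicCube.descendants j R).filter (· ∈ W))
    (fun j => 2 ^ (k * (d - κ') : ℝ) * 2 ^ (-((d - κ') * j))) ?_).trans ?_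
  · intro Q hQ
    have hQP : Q.1 ∈ shadowCubes W ρ P := by
      by_contra h
      exact hQ (if_neg h)
    have h1 := hk W Q P hQP
    obtain ⟨j, hj⟩ : ∃ j : ℕ, Q.1.scale + j = P.scale + k :=
      ⟨(P.scale + k - Q.1.scale).toNat, by omega⟩
    have hA := DyadicCube.isDescendant_ancestor j Q.1
    have hAs : (Q.1.ancestor j).scale = P.scale + k := hA.1.symm.trans hj
    refine ⟨j, ?_, ?_⟩
    · simp only [Finset.mem_biUnion, Finset.mem_filter, DyadicCube.mem_descendants]
      refine ⟨Q.1.ancestor j, hFmem _ hAs fun i => ?_, hA, Q.2⟩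
      have h2 := abs_le.1 ((abs_sub_apply_le_dist _ _ i).trans
        (dist_center_lt_of_mem_shadowCubes hQP).le)
      have h3 := abs_lt.1 (DyadicCube.abs_sub_center_lt (hA.subset Q.1.center_mem) i)
      have h4 : (Q.1.ancestor j).side = 2 ^ k * P.side := DyadicCube.side_eq_pow_mul hAs.symm
      have hP := P.side_pos
      have h5 : 8 * ρ * P.side ≤ (Q.1.ancestor j).side := by
        rw [h4]
        gcongr
      have h6 := (Q.1.ancestor j).side_pos
      rw [abs_le]
      constructor <;> linarith
    · rw [if_pos hQP, ← ENNReal.rpow_add _ _ two_ne_zero ENNReal.ofNat_ne_top]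
      have : (Q.1.scale : ℝ) = P.scale + k - j := by
        have : (Q.1.scale : ℝ) + j = P.scale + k := by exact_mod_cast hj
        linarith
      rw [this]
      refine le_of_eq ?_
      ring_nf
  · rw [← ENNReal.tsum_mul_left, ← ENNReal.tsum_mul_left, ← ENNReal.tsum_mul_left]
    refine ENNReal.tsum_le_tsum fun j => ?_
    have hcard : ((F.biUnion fun R => (DyadicCube.descendants j R).filter (· ∈ W)).card : ℝ≥0∞) ≤
        M * (C₀ * 2 ^ ((d - κ) * j : ℝ)) := by
      calc ((F.biUnion fun R => (DyadicCube.descendants j R).filter (· ∈ W)).card : ℝ≥0∞)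
          ≤ ∑ R ∈ F, (((DyadicCube.descendants j R).filter (· ∈ W)).card : ℝ≥0∞) := by
            exact_mod_cast Finset.card_biUnion_le
        _ ≤ ∑ _R ∈ F, (C₀ * 2 ^ ((d - κ) * j : ℝ) : ℝ≥0∞) :=
            Finset.sum_le_sum fun R _ => hC₀ Ω W hΩ j R
        _ ≤ _ := by
            rw [Finset.sum_const, nsmul_eq_mul]
            gcongr
    calc _ ≤ M * (C₀ * 2 ^ ((d - κ) * j : ℝ)) *
          (2 ^ (k * (d - κ') : ℝ) * 2 ^ (-((d - κ') * j)) : ℝ≥0∞) := by gcongr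
      _ = M * (C₀ * (2 ^ (k * (d - κ') : ℝ) *
          (2 ^ ((d - κ) * j : ℝ) * 2 ^ (-((d - κ') * j))))) := by ring
      _ = _ := by
          rw [← ENNReal.rpow_add ((d - κ) * j) _ two_ne_zero ENNReal.ofNat_ne_top]
          ring_nf

open Classical in
/-- The operator that sums over all `P` whose shadow contains `Q` is bounded on `ℓ^p` with weights
`|Q|`. The packing condition with an exponent smaller than `d` leaves room for Hölder's inequality
with weights that are powers of `ℓ(Q) / ℓ(P)`, so that no maximal function is needed. -/
theorem exists_tsum_rpow_tsum_shadow_le (hd : 1 ≤ d) {ε : ℝ} (hε : 0 < ε) (ρ : ℝ) {p : ℝ}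
    (hp : 1 ≤ p) : ∃ C : ℝ≥0, ∀ (Ω : Set (EuclideanSpace ℝ (Fin d))) (W : Set (DyadicCube d)),
      IsUniformDomainWith ε Ω W → ∀ b : W → ℝ≥0∞,
        ∑' Q : W, volume Q.1.toSet * (∑' P : W, if Q.1 ∈ shadowCubes W ρ P then b P else 0) ^ p ≤
          C * ∑' P : W, volume P.1.toSet * b P ^ p := by
  obtain ⟨κ, hκ, hpack⟩ := exists_tsum_shadow_le hd hε
  have hp0 : 0 < p := by linarith
  -- The factor `(ℓ(P) / ℓ(Q)) ^ (η * (p - 1))` lost in Hölder's inequality has to be compensated by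
  -- the packing condition.
  set η : ℝ := κ / (2 * p) with hη
  have hηpos : 0 < η := by positivity
  have hlt : η * (p - 1) < κ := by
    rw [hη, div_mul_eq_mul_div, div_lt_iff₀ (by positivity)]
    nlinarith
  obtain ⟨C₁, hC₁⟩ := hpack _ hlt ρ
  obtain ⟨C₂, hC₂⟩ := exists_tsum_ancestors_le hd ρ hηpos
  have hvol : ∀ Q : DyadicCube d, volume Q.toSet = 2 ^ (d * Q.scale : ℝ) := by
    intro Q
    rw [Q.volume_toSet, DyadicCube.side, ← Real.rpow_intCast,
      ← ENNReal.ofReal_rpow_of_pos two_pos, ENNReal.ofReal_ofNat, ← ENNReal.rpow_natCast,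
      ← ENNReal.rpow_mul, mul_comm]
  refine ⟨C₂ ^ (p - 1) * C₁, fun Ω W hΩ b => ?_⟩
  have key : ∀ Q : W, (∑' P : W, if Q.1 ∈ shadowCubes W ρ P then b P else 0) ^ p ≤
      C₂ ^ (p - 1) * ∑' P : W, if Q.1 ∈ shadowCubes W ρ P then
        2 ^ (η * (p - 1) * (P.1.scale - Q.1.scale) : ℝ) * b P ^ p else 0 := by
    intro Q
    set w : W → ℝ≥0∞ := fun P => if Q.1 ∈ shadowCubes W ρ P then
        (2 : ℝ≥0∞) ^ (-(η * (P.1.scale - Q.1.scale)) : ℝ) else 0 with hw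
    have h1 : ∀ P : W, (if Q.1 ∈ shadowCubes W ρ P then b P else 0) =
        w P * (2 ^ (η * (P.1.scale - Q.1.scale) : ℝ) * b P) := by
      intro P
      simp only [hw]
      split_ifs
      · rw [← mul_assoc, ← ENNReal.rpow_add _ _ two_ne_zero ENNReal.ofNat_ne_top]
        simp
      · simp
    have h2 : ∀ P : W, w P * (2 ^ (η * (P.1.scale - Q.1.scale) : ℝ) * b P) ^ p =
        if Q.1 ∈ shadowCubes W ρ P then
        2 ^ (η * (p - 1) * (P.1.scale - Q.1.scale) : ℝ) * b P ^ p else 0 := by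
      intro P
      simp only [hw]
      split_ifs
      · rw [ENNReal.mul_rpow_of_nonneg _ _ hp0.le, ← mul_assoc, ← ENNReal.rpow_mul,
          ← ENNReal.rpow_add _ _ two_ne_zero ENNReal.ofNat_ne_top]
        congr 2
        ring
      · simp
    simp_rw [h1]
    refine (tsum_mul_le_rpow hp _ _).trans ?_
    simp_rw [h2]
    gcongr
    exact hC₂ W Q
  calc ∑' Q : W, volume Q.1.toSet * (∑' P : W, if Q.1 ∈ shadowCubes W ρ P then b P else 0) ^ p
      ≤ ∑' Q : W, volume Q.1.toSet * (C₂ ^ (p - 1) * ∑' P : W, if Q.1 ∈ shadowCubes W ρ P then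
        2 ^ (η * (p - 1) * (P.1.scale - Q.1.scale) : ℝ) * b P ^ p else 0) := by
        gcongr with Q
        exact key Q
    _ = C₂ ^ (p - 1) * ∑' Q : W, ∑' P : W, (if Q.1 ∈ shadowCubes W ρ P then
        2 ^ ((d - η * (p - 1)) * (Q.1.scale - P.1.scale) : ℝ) else 0) *
          (volume P.1.toSet * b P ^ p) := by
        rw [← ENNReal.tsum_mul_left]
        refine tsum_congr fun Q => ?_
        rw [mul_left_comm, ← ENNReal.tsum_mul_left]
        congr 1
        refine tsum_congr fun P => ?_
        split_ifs
        · rw [hvol, hvol, ← mul_assoc, ← mul_assoc,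
            ← ENNReal.rpow_add _ _ two_ne_zero ENNReal.ofNat_ne_top,
            ← ENNReal.rpow_add _ _ two_ne_zero ENNReal.ofNat_ne_top]
          congr 2
          ring
        · simp
    _ = C₂ ^ (p - 1) * ∑' P : W, (∑' Q : W, if Q.1 ∈ shadowCubes W ρ P then
        2 ^ ((d - η * (p - 1)) * (Q.1.scale - P.1.scale) : ℝ) else 0) *
          (volume P.1.toSet * b P ^ p) := by
        rw [ENNReal.tsum_comm]
        simp_rw [ENNReal.tsum_mul_right]
    _ ≤ C₂ ^ (p - 1) * ∑' P : W, C₁ * (volume P.1.toSet * b P ^ p) := by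
        gcongr with P
        exact hC₁ Ω W hΩ P
    _ = _ := by
        rw [ENNReal.tsum_mul_left, ← mul_assoc, ENNReal.coe_mul,
          ENNReal.coe_rpow_of_nonneg _ (by linarith)]

/-! ### Norms of difference quotients -/

theorem eLpNorm_const_mul_ennreal {α : Type*} [MeasurableSpace α] {μ : Measure α} {q : ℝ≥0∞}
    (hq : 1 ≤ q) (c : ℝ≥0∞) {g : α → ℝ≥0∞} (hg : Measurable g) :
    eLpNorm (fun z => c * g z) q μ = c * eLpNorm g q μ := by
  have hq0 : q ≠ 0 := (zero_lt_one.trans_le hq).ne'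
  by_cases hqt : q = ∞
  · subst hqt
    simp only [eLpNorm_exponent_top, eLpNormEssSup, enorm_eq_self]
    exact ENNReal.essSup_const_mul
  · have hqr := ENNReal.toReal_pos hq0 hqt
    simp only [eLpNorm_eq_lintegral_rpow_enorm_toReal hq0 hqt, enorm_eq_self,
      ENNReal.mul_rpow_of_nonneg _ _ hqr.le]
    rw [lintegral_const_mul _ (hg.pow_const _), ENNReal.mul_rpow_of_nonneg _ _ (by positivity),
      ← ENNReal.rpow_mul, mul_one_div_cancel hqr.ne', ENNReal.rpow_one]

/-- Minkowski's inequality for countable sums of nonnegative functions. -/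
theorem eLpNorm_tsum_ennreal_le {α ι : Type*} [Countable ι] [MeasurableSpace α] {μ : Measure α}
    {q : ℝ≥0∞} (hq : 1 ≤ q) {f : ι → α → ℝ≥0∞} (hf : ∀ i, Measurable (f i)) :
    eLpNorm (fun x => ∑' i, f i x) q μ ≤ ∑' i, eLpNorm (f i) q μ := by
  have hq0 : q ≠ 0 := (zero_lt_one.trans_le hq).ne'
  by_cases hqt : q = ∞
  · subst hqt
    simp only [eLpNorm_exponent_top, eLpNormEssSup, enorm_eq_self]
    refine essSup_le_of_ae_le _ ?_
    filter_upwards [ae_all_iff.2 fun i => ENNReal.ae_le_essSup (μ := μ) (f i)] with x hx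
    exact ENNReal.tsum_le_tsum hx
  · have hqr := ENNReal.toReal_pos hq0 hqt
    have hfin : ∀ s : Finset ι, (∫⁻ x, (∑ i ∈ s, f i x) ^ q.toReal ∂μ) ≤
        (∑' i, eLpNorm (f i) q μ) ^ q.toReal := by
      intro s
      have h := (eLpNorm_sum_le (s := s) (f := f) (μ := μ)
        (fun i _ => (hf i).aestronglyMeasurable) hq).trans (ENNReal.sum_le_tsum s)
      rw [eLpNorm_eq_lintegral_rpow_enorm_toReal hq0 hqt, one_div,
        ENNReal.rpow_inv_le_iff hqr] at h
      simpa [Finset.sum_apply] using h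
    rw [eLpNorm_eq_lintegral_rpow_enorm_toReal hq0 hqt, one_div, ENNReal.rpow_inv_le_iff hqr]
    simp only [enorm_eq_self]
    have hsup : ∀ x, (∑' i, f i x) ^ q.toReal = ⨆ s : Finset ι, (∑ i ∈ s, f i x) ^ q.toReal := by
      intro x
      rw [ENNReal.tsum_eq_iSup_sum]
      exact (ENNReal.orderIsoRpow q.toReal hqr).map_iSup _
    simp_rw [hsup]
    rw [lintegral_iSup_directed]
    · exact iSup_le hfin
    · exact fun s => ((Finset.measurable_sum s fun i _ => hf i).pow_const _).aemeasurable
    · classical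
      intro s t
      refine ⟨s ∪ t, fun x => ?_, fun x => ?_⟩
      · exact ENNReal.rpow_le_rpow (Finset.sum_le_sum_of_subset Finset.subset_union_left) hqr.le
      · exact ENNReal.rpow_le_rpow (Finset.sum_le_sum_of_subset Finset.subset_union_right) hqr.le

/-- The difference quotient `|f(x) - f(y)| / |x - y|^t`. With `t = s + d / q`, its `L^q` norm in `y`
is the inner norm, also for `q = ∞`. -/
noncomputable def diffQuot (t : ℝ) (f : EuclideanSpace ℝ (Fin d) → ℂ)
    (x y : EuclideanSpace ℝ (Fin d)) : ℝ≥0∞ :=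
  ‖f x - f y‖ₑ / ‖x - y‖ₑ ^ t

section

variable {f : EuclideanSpace ℝ (Fin d) → ℂ} {s t : ℝ} {q : ℝ≥0∞}
  {A B : Set (EuclideanSpace ℝ (Fin d))}

theorem measurable_diffQuot (hf : Measurable f) (x : EuclideanSpace ℝ (Fin d)) :
    Measurable (diffQuot t f x) := by
  unfold diffQuot
  fun_prop

theorem enorm_sub_le_diffQuot (ht : 0 < t) (x y : EuclideanSpace ℝ (Fin d)) {R : ℝ≥0∞}
    (hR : ‖x - y‖ₑ ≤ R) : ‖f x - f y‖ₑ ≤ R ^ t * diffQuot t f x y := by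
  rcases eq_or_ne x y with rfl | hxy
  · simp
  have h0 : ‖x - y‖ₑ ^ t ≠ 0 := by
    simp [ENNReal.rpow_eq_zero_iff, sub_ne_zero.2 hxy, ht.not_gt]
  have h1 : ‖x - y‖ₑ ^ t ≠ ∞ := ENNReal.rpow_ne_top_of_nonneg ht.le enorm_ne_top
  calc ‖f x - f y‖ₑ = ‖x - y‖ₑ ^ t * diffQuot t f x y := by
        rw [diffQuot, ENNReal.mul_div_cancel h0 h1]
    _ ≤ _ := by gcongr

theorem innerNorm_eq_eLpNorm (hq : 1 ≤ q) (f : EuclideanSpace ℝ (Fin d) → ℂ)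
    (A : Set (EuclideanSpace ℝ (Fin d))) (x : EuclideanSpace ℝ (Fin d)) :
    innerNorm s q f A x = eLpNorm (diffQuot (s + d / q.toReal) f x) q (volume.restrict A) := by
  have hq0 : q ≠ 0 := (zero_lt_one.trans_le hq).ne'
  unfold innerNorm diffQuot
  split_ifs with hqt
  · subst hqt
    simp [eLpNorm_exponent_top, eLpNormEssSup]
  · have hqr := ENNReal.toReal_pos hq0 hqt
    rw [eLpNorm_eq_lintegral_rpow_enorm_toReal hq0 hqt]
    simp only [enorm_eq_self, ENNReal.div_rpow_of_nonneg _ _ hqr.le, ← ENNReal.rpow_mul, add_mul,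
      div_mul_cancel₀ _ hqr.ne']

theorem innerNorm_mono (hq : 1 ≤ q) (h : A ⊆ B) (x : EuclideanSpace ℝ (Fin d)) :
    innerNorm s q f A x ≤ innerNorm s q f B x := by
  rw [innerNorm_eq_eLpNorm hq, innerNorm_eq_eLpNorm hq]
  exact eLpNorm_mono_measure _ (Measure.restrict_mono h le_rfl)

theorem measurable_innerNorm (hf : Measurable f) (A : Set (EuclideanSpace ℝ (Fin d))) :
    Measurable (innerNorm s q f A) := by
  unfold innerNorm
  split_ifs with hqt
  · refine measurable_of_Iic fun c => ?_
    have hm : MeasurableSet {z : EuclideanSpace ℝ (Fin d) × EuclideanSpace ℝ (Fin d) |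
        c < ‖f z.1 - f z.2‖ₑ / ‖z.1 - z.2‖ₑ ^ s} := measurableSet_lt (by fun_prop) (by fun_prop)
    have h := measurable_measure_prodMk_left (ν := volume.restrict A) hm
    convert h (measurableSet_singleton 0) using 1
    ext x
    simp only [mem_preimage, mem_Iic, mem_singleton_iff]
    constructor
    · intro hx
      have := (ENNReal.ae_le_essSup (μ := volume.restrict A)
        fun y => ‖f x - f y‖ₑ / ‖x - y‖ₑ ^ s).mono fun y hy => hy.trans hx
      rw [ae_iff] at this
      simpa using this
    · intro hx
      refine essSup_le_of_ae_le c ?_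
      change ∀ᵐ y ∂(volume.restrict A), ‖f x - f y‖ₑ / ‖x - y‖ₑ ^ s ≤ c
      rw [ae_iff]
      simpa using hx
  · refine Measurable.pow_const ?_ _
    exact Measurable.lintegral_prod_right' (f := fun z : EuclideanSpace ℝ (Fin d) ×
      EuclideanSpace ℝ (Fin d) => ‖f z.1 - f z.2‖ₑ ^ q.toReal / ‖z.1 - z.2‖ₑ ^ (s * q.toReal + d))
      (by fun_prop)

theorem innerNorm_congr {g : EuclideanSpace ℝ (Fin d) → ℂ} (h : f =ᵐ[volume.restrict A] g)
    {x : EuclideanSpace ℝ (Fin d)} (hx : f x = g x) :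
    innerNorm s q f A x = innerNorm s q g A x := by
  unfold innerNorm
  split_ifs
  · refine essSup_congr_ae ?_
    filter_upwards [h] with y hy
    rw [hx, hy]
  · congr 1
    refine lintegral_congr_ae ?_
    filter_upwards [h] with y hy
    rw [hx, hy]

/-- The difference of two values of `f` is controlled by inner norms at these two points over any
set `E` within distance `C * r` of both points and of measure at least `r ^ d`. -/
theorem enorm_sub_le_innerNorm (hs : 0 < s) (hq : 1 ≤ q) (hf : Measurable f)
    {E : Set (EuclideanSpace ℝ (Fin d))} (hE : MeasurableSet E) {r C : ℝ} (hr : 0 < r) (hC : 0 ≤ C)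
    (hvol : ENNReal.ofReal r ^ d ≤ volume E) {a b : EuclideanSpace ℝ (Fin d)}
    (ha : ∀ z ∈ E, dist a z ≤ C * r) (hb : ∀ z ∈ E, dist b z ≤ C * r) :
    ‖f a - f b‖ₑ ≤ ENNReal.ofReal C ^ (s + d / q.toReal) * ENNReal.ofReal r ^ s *
      (innerNorm s q f E a + innerNorm s q f E b) := by
  have hq0 : q ≠ 0 := (zero_lt_one.trans_le hq).ne'
  set t := s + d / q.toReal with ht
  have htpos : 0 < t := by positivity
  have hr0 : ENNReal.ofReal r ≠ 0 := by simpa using hr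
  have hrt : ENNReal.ofReal r ≠ ∞ := ENNReal.ofReal_ne_top
  set R := ENNReal.ofReal (C * r) with hR
  have hE0 : volume.restrict E ≠ 0 := by
    rw [Ne, Measure.restrict_eq_zero]
    intro h
    rw [h, nonpos_iff_eq_zero] at hvol
    exact pow_ne_zero d hr0 hvol
  have h1 : ‖f a - f b‖ₑ * ENNReal.ofReal r ^ (d / q.toReal) ≤
      eLpNorm (fun _ : EuclideanSpace ℝ (Fin d) => ‖f a - f b‖ₑ) q (volume.restrict E) := by
    rw [eLpNorm_const _ hq0 hE0, enorm_eq_self, Measure.restrict_apply_univ]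
    gcongr
    calc ENNReal.ofReal r ^ (d / q.toReal) = (ENNReal.ofReal r ^ d) ^ (1 / q.toReal) := by
          rw [← ENNReal.rpow_natCast, ← ENNReal.rpow_mul, mul_one_div]
      _ ≤ _ := by gcongr
  have h2 : eLpNorm (fun _ : EuclideanSpace ℝ (Fin d) => ‖f a - f b‖ₑ) q (volume.restrict E) ≤
      eLpNorm ((fun z => R ^ t * diffQuot t f a z) + fun z => R ^ t * diffQuot t f b z) q
        (volume.restrict E) := by
    refine eLpNorm_mono_enorm_ae ?_
    filter_upwards [ae_restrict_mem hE] with z hz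
    simp only [enorm_eq_self, Pi.add_apply]
    have hda : ‖a - z‖ₑ ≤ R := by
      rw [← edist_eq_enorm_sub, edist_dist]
      exact ENNReal.ofReal_le_ofReal (ha z hz)
    have hdb : ‖b - z‖ₑ ≤ R := by
      rw [← edist_eq_enorm_sub, edist_dist]
      exact ENNReal.ofReal_le_ofReal (hb z hz)
    calc ‖f a - f b‖ₑ = edist (f a) (f b) := (edist_eq_enorm_sub _ _).symm
      _ ≤ edist (f a) (f z) + edist (f b) (f z) := edist_triangle_right _ _ _
      _ ≤ _ := by
        rw [edist_eq_enorm_sub, edist_eq_enorm_sub]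
        exact add_le_add (enorm_sub_le_diffQuot htpos a z hda) (enorm_sub_le_diffQuot htpos b z hdb)
  have hma := measurable_diffQuot (t := t) hf a
  have hmb := measurable_diffQuot (t := t) hf b
  have h3 := eLpNorm_add_le (μ := volume.restrict E) (p := q)
    (f := fun z => R ^ t * diffQuot t f a z) (g := fun z => R ^ t * diffQuot t f b z)
    (hma.const_mul _).aestronglyMeasurable (hmb.const_mul _).aestronglyMeasurable hq
  rw [eLpNorm_const_mul_ennreal hq _ hma, eLpNorm_const_mul_ennreal hq _ hmb, ← mul_add,
    ← innerNorm_eq_eLpNorm hq, ← innerNorm_eq_eLpNorm hq] at h3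
  have h4 : R ^ t = ENNReal.ofReal C ^ t * ENNReal.ofReal r ^ s *
      ENNReal.ofReal r ^ (d / q.toReal) := by
    rw [hR, ENNReal.ofReal_mul hC, ENNReal.mul_rpow_of_nonneg _ _ htpos.le, mul_assoc,
      ← ENNReal.rpow_add _ _ hr0 hrt]
  have h5 := h1.trans (h2.trans h3)
  rw [h4] at h5
  have h6 : ENNReal.ofReal r ^ (d / q.toReal) ≠ 0 := by
    rw [Ne, ENNReal.rpow_eq_zero_iff]
    simp [hr0, hrt]
  have h7 : ENNReal.ofReal r ^ (d / q.toReal) ≠ ∞ :=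
    ENNReal.rpow_ne_top_of_nonneg (by positivity) hrt
  refine (ENNReal.mul_le_mul_iff_left h6 h7).1 (h5.trans (le_of_eq ?_))
  ring

open Classical in
/-- The kernel `|x - y|^(-t)`, cut off at the distance `r`. -/
noncomputable def tailKernel (t r : ℝ) (x y : EuclideanSpace ℝ (Fin d)) : ℝ≥0∞ :=
  if r ≤ dist x y then (‖x - y‖ₑ ^ t)⁻¹ else 0

theorem measurable_tailKernel (t r : ℝ) (x : EuclideanSpace ℝ (Fin d)) :
    Measurable (tailKernel t r x) := by
  unfold tailKernel
  exact Measurable.ite (measurableSet_le measurable_const (by fun_prop)) (by fun_prop) (by fun_prop)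

theorem exists_eLpNorm_tailKernel_le (d : ℕ) (hs : 0 < s) (hq : 1 ≤ q) :
    ∃ C : ℝ≥0, ∀ (x : EuclideanSpace ℝ (Fin d)) (r : ℝ), 0 < r →
      eLpNorm (tailKernel (s + d / q.toReal) r x) q volume ≤ C * ENNReal.ofReal r ^ (-s) := by
  set V := volume (Metric.ball (0 : EuclideanSpace ℝ (Fin d)) 1) with hV
  set u : ℝ := d / q.toReal with hu
  have hu0 : 0 ≤ u := by positivity
  have hne : V ^ (1 / q.toReal) * 2 ^ u * ∑' k : ℕ, (2 : ℝ≥0∞) ^ (-(s * k)) ≠ ∞ :=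
    ENNReal.mul_ne_top (ENNReal.mul_ne_top
      (ENNReal.rpow_ne_top_of_nonneg (by positivity) measure_ball_lt_top.ne)
      (ENNReal.rpow_ne_top_of_nonneg hu0 ENNReal.ofNat_ne_top)) (tsum_two_rpow_neg_ne_top hs)
  refine ⟨_, fun x r hr => le_trans ?_ (mul_le_mul_left (ENNReal.coe_toNNReal hne).ge _)⟩
  set R := ENNReal.ofReal r with hR
  have hr0 : R ≠ 0 := by simpa [hR] using hr
  have hrt : R ≠ ∞ := ENNReal.ofReal_ne_top
  -- Dyadic annuli around `x`.
  set g : ℕ → EuclideanSpace ℝ (Fin d) → ℝ≥0∞ := fun k =>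
    (Metric.ball x (2 ^ (k + 1) * r)).indicator fun _ => ((2 ^ k * R) ^ (s + u))⁻¹ with hg
  have hle : eLpNorm (tailKernel (s + u) r x) q volume ≤
      eLpNorm (fun y => ∑' k, g k y) q volume := by
    refine eLpNorm_mono_enorm fun y => ?_
    simp only [enorm_eq_self, tailKernel]
    split_ifs with hy
    · obtain ⟨k, hk1, hk2⟩ := exists_nat_pow_near ((one_le_div hr).2 hy) one_lt_two
      rw [le_div_iff₀ hr] at hk1
      rw [div_lt_iff₀ hr] at hk2
      refine le_trans ?_ (ENNReal.le_tsum k)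
      have hmem : y ∈ Metric.ball x (2 ^ (k + 1) * r) := by rwa [Metric.mem_ball, dist_comm]
      simp only [hg, indicator_of_mem hmem]
      gcongr
      rw [← edist_eq_enorm_sub, edist_dist]
      refine le_trans (le_of_eq ?_) (ENNReal.ofReal_le_ofReal hk1)
      rw [ENNReal.ofReal_mul (by positivity), ENNReal.ofReal_pow (by norm_num), ENNReal.ofReal_ofNat]
    · exact zero_le
  refine hle.trans ((eLpNorm_tsum_ennreal_le hq fun k =>
    measurable_const.indicator measurableSet_ball).trans ?_)
  rw [mul_assoc, ← ENNReal.tsum_mul_right, ← ENNReal.tsum_mul_left]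
  refine ENNReal.tsum_le_tsum fun k => (eLpNorm_indicator_const_le _ q).trans (le_of_eq ?_)
  rw [enorm_eq_self, Measure.addHaar_ball_of_pos _ _ (by positivity),
    finrank_euclideanSpace_fin, ENNReal.mul_rpow_of_nonneg (ENNReal.ofReal _) _ (by positivity), ← hV]
  have h2k0 : (2 ^ k * R : ℝ≥0∞) ≠ 0 := mul_ne_zero (by simp) hr0
  have h2kt : (2 ^ k * R : ℝ≥0∞) ≠ ∞ := ENNReal.mul_ne_top (by simp) hrt
  have h1 : (ENNReal.ofReal ((2 ^ (k + 1) * r) ^ d)) ^ (1 / q.toReal) =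
      2 ^ u * (2 ^ k * R) ^ u := by
    rw [ENNReal.ofReal_pow (by positivity), ENNReal.ofReal_mul (by positivity),
      ENNReal.ofReal_pow (by norm_num), ENNReal.ofReal_ofNat, ← ENNReal.rpow_natCast _ d,
      ← ENNReal.rpow_mul, mul_one_div, ← hu, ← ENNReal.mul_rpow_of_nonneg _ _ hu0, pow_succ]
    congr 1
    ring
  have h2 : ((2 ^ k * R) ^ (s + u) : ℝ≥0∞)⁻¹ * (2 ^ k * R) ^ u = 2 ^ (-(s * k)) * R ^ (-s) := by
    rw [← ENNReal.rpow_neg, ← ENNReal.rpow_add _ _ h2k0 h2kt, neg_add, neg_add_cancel_right,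
      ENNReal.mul_rpow_of_ne_zero (by simp) hr0, ← ENNReal.rpow_natCast, ← ENNReal.rpow_mul]
    ring_nf
  rw [h1]
  calc _ = V ^ (1 / q.toReal) * 2 ^ u * (((2 ^ k * R) ^ (s + u) : ℝ≥0∞)⁻¹ * (2 ^ k * R) ^ u) := by
        ring
    _ = _ := by rw [h2]

end

/-! ### Neighboring cubes outside the shadow -/

/-- Reflection across the faces by which a dyadic cube `Q` is separated from a neighbor `S` of twice
its size maps `Q` into `S`. Here `δ` is the distance of `x` to `S` in the maximum norm. -/
theorem exists_reflection {Q S : DyadicCube d} (hN : Neighbors Q S) (hscale : S.scale = Q.scale + 1)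
    (hdisj : Disjoint Q.toSet S.toSet) :
    ∃ T : EuclideanSpace ℝ (Fin d) → EuclideanSpace ℝ (Fin d), MeasurePreserving T ∧
      (∀ x ∈ Q.toSet, T x ∈ S.toSet) ∧ ∀ x ∈ Q.toSet, ∃ δ : ℝ, 0 < δ ∧ δ ≤ Q.side ∧
        dist x (T x) ≤ 2 * √d * δ ∧ ∀ y ∈ S.toSet, δ ≤ dist x y ∧ dist (T x) y ≤ dist x y := by
  classical
  have hℓ := Q.side_pos
  have hS : S.side = 2 * Q.side := by
    simpa using DyadicCube.side_eq_pow_mul (Q := Q) (R := S) (j := 1) hscale.symm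
  have hN' := neighbors_iff.1 hN
  rw [hS] at hN'
  have hidx : ∀ i, Q.index i ≤ 2 * S.index i + 2 ∧ 2 * S.index i ≤ Q.index i + 1 := by
    intro i
    obtain ⟨h1, h2⟩ := hN' i
    have h3 : (Q.index i : ℝ) ≤ 2 * S.index i + 2 := by
      refine le_of_mul_le_mul_left ?_ hℓ
      linarith
    have h4 : 2 * (S.index i : ℝ) ≤ Q.index i + 1 := by
      refine le_of_mul_le_mul_left ?_ hℓ
      linarith
    exact ⟨by exact_mod_cast h3, by exact_mod_cast h4⟩
  set right : Fin d → Prop := fun i => Q.index i = 2 * S.index i + 2 with hright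
  set left : Fin d → Prop := fun i => 2 * S.index i = Q.index i + 1 with hleft
  set c : Fin d → ℝ := fun i =>
    if right i then Q.side * Q.index i else Q.side * (Q.index i + 1) with hc
  set L : EuclideanSpace ℝ (Fin d) ≃ₗᵢ[ℝ] EuclideanSpace ℝ (Fin d) :=
    LinearIsometryEquiv.piLpCongrRight 2 fun i =>
      if right i ∨ left i then LinearIsometryEquiv.neg ℝ else LinearIsometryEquiv.refl ℝ ℝ with hL
  set τ : EuclideanSpace ℝ (Fin d) :=
    WithLp.toLp 2 fun i => if right i ∨ left i then 2 * c i else 0 with hτ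
  have hT1 : ∀ x i, right i ∨ left i → (τ + L x) i = 2 * c i - x i := by
    intro x i hi
    simp [hτ, hL, hi, sub_eq_add_neg]
  have hT2 : ∀ x i, ¬ (right i ∨ left i) → (τ + L x) i = x i := by
    intro x i hi
    simp [hτ, hL, hi]
  have hfact : ∀ x ∈ Q.toSet, ∀ i, right i ∨ left i → 0 < |x i - c i| ∧ |x i - c i| ≤ Q.side ∧
      (S.side * S.index i < 2 * c i - x i ∧ 2 * c i - x i < S.side * (S.index i + 1)) ∧
      ∀ y ∈ S.toSet, |x i - c i| ≤ |x i - y i| ∧ |2 * c i - x i - y i| ≤ |x i - y i| := by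
    intro x hx i hi
    have h1 := hx i
    by_cases hr : right i
    · have hci : c i = Q.side * Q.index i := if_pos hr
      have hr' : (Q.index i : ℝ) = 2 * S.index i + 2 := by exact_mod_cast hr
      have hpos : 0 < x i - c i := by rw [hci]; linarith
      have hcS : c i = S.side * (S.index i + 1) := by rw [hci, hr', hS]; ring
      refine ⟨abs_pos.2 hpos.ne', ?_, ⟨?_, ?_⟩, fun y hy => ?_⟩
      · rw [abs_of_pos hpos, hci]; linarith
      · rw [hS] at hcS ⊢; linarith
      · linarith
      · have h2 := hy i
        rw [abs_of_pos hpos, abs_of_pos (by linarith : 0 < x i - y i)]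
        refine ⟨by linarith, abs_le.2 ⟨by linarith, by linarith⟩⟩
    · have hl : left i := hi.resolve_left hr
      have hci : c i = Q.side * (Q.index i + 1) := if_neg hr
      have hl' : 2 * (S.index i : ℝ) = Q.index i + 1 := by exact_mod_cast hl
      have hneg : x i - c i < 0 := by rw [hci]; linarith
      have hcS : c i = S.side * S.index i := by rw [hci, ← hl', hS]; ring
      refine ⟨abs_pos.2 hneg.ne, ?_, ⟨?_, ?_⟩, fun y hy => ?_⟩
      · rw [abs_of_neg hneg, hci]; linarith
      · linarith
      · rw [hS] at hcS ⊢; linarith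
      · have h2 := hy i
        rw [abs_of_neg hneg, abs_of_neg (by linarith : x i - y i < 0)]
        refine ⟨by linarith, abs_le.2 ⟨by linarith, by linarith⟩⟩
  have hin : ∀ x ∈ Q.toSet, ∀ i, ¬ (right i ∨ left i) →
      S.side * S.index i < x i ∧ x i < S.side * (S.index i + 1) := by
    intro x hx i hi
    have h1 := hx i
    have h2 := hidx i
    simp only [hright, hleft, not_or] at hi
    have h3 : 2 * (S.index i : ℝ) ≤ Q.index i := by
      have : 2 * S.index i ≤ Q.index i := by omega
      exact_mod_cast this
    have h4 : (Q.index i : ℝ) + 1 ≤ 2 * S.index i + 2 := by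
      have : Q.index i + 1 ≤ 2 * S.index i + 2 := by omega
      exact_mod_cast this
    rw [hS]
    constructor <;> nlinarith
  have hne : ∃ i, right i ∨ left i := by
    by_contra! h
    refine disjoint_left.1 hdisj Q.center_mem fun i => hin _ Q.center_mem i ?_
    simpa using h i
  refine ⟨fun x => τ + L x, (measurePreserving_add_left volume τ).comp L.measurePreserving,
    fun x hx i => ?_, fun x hx => ?_⟩
  · change _ < (τ + L x) i ∧ (τ + L x) i < _
    by_cases hi : right i ∨ left i
    · rw [hT1 x i hi]
      exact (hfact x hx i hi).2.2.1
    · rw [hT2 x i hi]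
      exact hin x hx i hi
  · obtain ⟨k, hk, hmax⟩ := (Finset.univ.filter fun i => right i ∨ left i).exists_max_image
      (fun i => |x i - c i|) (by
        obtain ⟨i, hi⟩ := hne
        exact ⟨i, by simp [hi]⟩)
    simp only [Finset.mem_filter, Finset.mem_univ, true_and] at hk hmax
    obtain ⟨hk1, hk2, -, hk4⟩ := hfact x hx k hk
    refine ⟨|x k - c k|, hk1, hk2, ?_, fun y hy => ⟨?_, ?_⟩⟩
    · rw [mul_comm 2, mul_assoc]
      refine dist_le_sqrt_mul (by positivity) fun i => ?_
      by_cases hi : right i ∨ left i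
      · rw [hT1 x i hi, show x i - (2 * c i - x i) = 2 * (x i - c i) by ring, abs_mul, abs_two]
        have := hmax i hi
        linarith
      · rw [hT2 x i hi, sub_self, abs_zero]
        positivity
    · exact (hk4 y hy).1.trans (abs_sub_apply_le_dist x y k)
    · rw [EuclideanSpace.dist_eq, EuclideanSpace.dist_eq]
      refine Real.sqrt_le_sqrt (Finset.sum_le_sum fun i _ => ?_)
      rw [Real.dist_eq, Real.dist_eq]
      refine pow_le_pow_left₀ (abs_nonneg _) ?_ 2
      by_cases hi : right i ∨ left i
      · rw [hT1 x i hi]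
        exact ((hfact x hx i hi).2.2.2 y hy).2
      · rw [hT2 x i hi]

/-- A cube contains a fixed portion of each small ball centered in it. -/
theorem DyadicCube.exists_subset_near {Q : DyadicCube d} {x : EuclideanSpace ℝ (Fin d)}
    (hx : x ∈ Q.toSet) {δ : ℝ} (hδ : 0 < δ) (hle : δ ≤ Q.side) :
    ∃ E ⊆ Q.toSet, MeasurableSet E ∧ ENNReal.ofReal (δ / 2) ^ d ≤ volume E ∧
      ∀ z ∈ E, dist x z ≤ √d * (δ / 2) := by
  classical
  set a : Fin d → ℝ := fun i => if x i ≤ Q.center i then x i else x i - δ / 2 with ha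
  have hcase : ∀ i, (x i ≤ Q.center i ∧ a i = x i) ∨ (Q.center i < x i ∧ a i = x i - δ / 2) := by
    intro i
    rcases le_or_gt (x i) (Q.center i) with h | h
    · exact Or.inl ⟨h, if_pos h⟩
    · exact Or.inr ⟨h, if_neg h.not_ge⟩
  refine ⟨{z | ∀ i, a i < z i ∧ z i < a i + δ / 2}, fun z hz i => ?_,
    (isOpen_box _ _).measurableSet, ?_, fun z hz => dist_le_sqrt_mul (by positivity) fun i => ?_⟩
  · have h1 := hx i
    have h2 := hz i
    have h3 := Q.center_apply i
    rcases hcase i with ⟨h4, h5⟩ | ⟨h4, h5⟩ <;> constructor <;> linarith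
  · rw [volume_box]
    simp
  · have h2 := hz i
    rw [abs_le]
    rcases hcase i with ⟨h4, h5⟩ | ⟨h4, h5⟩ <;> constructor <;> linarith

variable {s : ℝ} {q : ℝ≥0∞}

/-- If `S` is a neighbor of `Q` of twice its size, then the part of the inner norm over `S` at a
point `x` of `Q` is controlled by inner norms at `x` and at the reflection of `x`. This is needed
because the shadow of a cube need not contain its larger neighbors. -/
theorem exists_innerNorm_neighbor_le (d : ℕ) (hs : 0 < s) (hq : 1 ≤ q) :
    ∃ C : ℝ≥0, ∀ Q S : DyadicCube d, Neighbors Q S → S.scale = Q.scale + 1 →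
      Disjoint Q.toSet S.toSet →
      ∃ T : EuclideanSpace ℝ (Fin d) → EuclideanSpace ℝ (Fin d), MeasurePreserving T ∧
        (∀ x ∈ Q.toSet, T x ∈ S.toSet) ∧
        ∀ f : EuclideanSpace ℝ (Fin d) → ℂ, Measurable f → ∀ x ∈ Q.toSet,
          innerNorm s q f S.toSet x ≤
            C * (innerNorm s q f Q.toSet x + innerNorm s q f (Q.toSet ∪ S.toSet) (T x)) := by
  obtain ⟨C₁, hC₁⟩ := exists_eLpNorm_tailKernel_le d hs hq
  set t := s + d / q.toReal with ht
  have htpos : 0 < t := by positivity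
  have hne : ENNReal.ofReal (5 * √d) ^ t * C₁ + 1 ≠ ∞ := ENNReal.add_ne_top.2
    ⟨ENNReal.mul_ne_top (ENNReal.rpow_ne_top_of_nonneg htpos.le ENNReal.ofReal_ne_top)
      ENNReal.coe_ne_top, ENNReal.one_ne_top⟩
  refine ⟨(ENNReal.ofReal (5 * √d) ^ t * C₁ + 1).toNNReal, fun Q S hN hscale hdisj => ?_⟩
  obtain ⟨T, hT, hTS, hTx⟩ := exists_reflection hN hscale hdisj
  refine ⟨T, hT, hTS, fun f hf x hx => ?_⟩
  rw [ENNReal.coe_toNNReal hne]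
  obtain ⟨δ, hδ, hδQ, hxT, hδS⟩ := hTx x hx
  obtain ⟨E, hEQ, hE, hvol, hdist⟩ := DyadicCube.exists_subset_near hx hδ hδQ
  have hsq := Real.sqrt_nonneg d
  have hjump := enorm_sub_le_innerNorm (a := x) (b := T x) (C := 5 * √d) hs hq hf hE
    (by positivity) (by positivity) hvol (fun z hz => by
      have := hdist z hz
      nlinarith [mul_nonneg hsq hδ.le]) (fun z hz => by
      have h1 := hdist z hz
      have h2 := dist_triangle_left (T x) z x
      linarith)
  have hEx : innerNorm s q f E x ≤ innerNorm s q f Q.toSet x := innerNorm_mono hq hEQ x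
  have hEy : innerNorm s q f E (T x) ≤ innerNorm s q f (Q.toSet ∪ S.toSet) (T x) :=
    innerNorm_mono hq (hEQ.trans subset_union_left) _
  have hSy : innerNorm s q f S.toSet (T x) ≤ innerNorm s q f (Q.toSet ∪ S.toSet) (T x) :=
    innerNorm_mono hq subset_union_right _
  set N := innerNorm s q f Q.toSet x + innerNorm s q f (Q.toSet ∪ S.toSet) (T x) with hN
  have hsum : ‖f x - f (T x)‖ₑ ≤
      ENNReal.ofReal (5 * √d) ^ t * ENNReal.ofReal δ ^ s * N := by
    refine hjump.trans ?_
    gcongr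
    · linarith
    · exact add_le_add hEx hEy
  have hmeas := measurable_diffQuot (t := t) hf (T x)
  have hker := measurable_tailKernel t δ x
  have hδ0 : ENNReal.ofReal δ ≠ 0 := by simpa using hδ
  calc innerNorm s q f S.toSet x
      ≤ eLpNorm ((fun y => ‖f x - f (T x)‖ₑ * tailKernel t δ x y) + diffQuot t f (T x)) q
          (volume.restrict S.toSet) := by
        rw [innerNorm_eq_eLpNorm hq]
        refine eLpNorm_mono_enorm_ae ?_
        filter_upwards [ae_restrict_mem S.measurableSet_toSet] with y hy
        obtain ⟨h1, h2⟩ := hδS y hy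
        simp only [enorm_eq_self, Pi.add_apply, tailKernel, if_pos h1]
        have h3 : ‖T x - y‖ₑ ≤ ‖x - y‖ₑ := by
          rw [← edist_eq_enorm_sub, ← edist_eq_enorm_sub, edist_dist, edist_dist]
          exact ENNReal.ofReal_le_ofReal h2
        calc diffQuot t f x y
            ≤ (‖f x - f (T x)‖ₑ + ‖f (T x) - f y‖ₑ) / ‖x - y‖ₑ ^ t := by
              rw [diffQuot]
              gcongr
              rw [← sub_add_sub_cancel (f x) (f (T x)) (f y)]
              exact enorm_add_le _ _
          _ ≤ _ := by
              rw [ENNReal.add_div, div_eq_mul_inv]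
              gcongr
              rw [diffQuot]
              gcongr
    _ ≤ ‖f x - f (T x)‖ₑ * (C₁ * ENNReal.ofReal δ ^ (-s)) + innerNorm s q f S.toSet (T x) := by
        refine (eLpNorm_add_le (hker.const_mul _).aestronglyMeasurable
          hmeas.aestronglyMeasurable hq).trans ?_
        rw [eLpNorm_const_mul_ennreal hq _ hker, innerNorm_eq_eLpNorm hq]
        gcongr
        exact (eLpNorm_mono_measure _ Measure.restrict_le_self).trans (hC₁ x δ hδ)
    _ ≤ ENNReal.ofReal (5 * √d) ^ t * ENNReal.ofReal δ ^ s * N *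
          (C₁ * ENNReal.ofReal δ ^ (-s)) + N := by
        gcongr
        exact hSy.trans le_add_self
    _ = (ENNReal.ofReal (5 * √d) ^ t * C₁ *
          (ENNReal.ofReal δ ^ s * ENNReal.ofReal δ ^ (-s)) + 1) * N := by ring
    _ = _ := by
        rw [← ENNReal.rpow_add _ _ hδ0 ENNReal.ofReal_ne_top, add_neg_cancel, ENNReal.rpow_zero,
          mul_one]

/-! ### Distant cubes -/

/-- Along a sequence whose consecutive jumps are bounded by the weights of the two points involved,
the total jump is bounded by twice the sum of the weights, in which a point that occurs repeatedly is
counted only once. -/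
theorem edist_add_le_two_mul_sum {α X : Type*} [DecidableEq α] [PseudoEMetricSpace X] (g : α → X)
    (w : α → ℝ≥0∞) (n : ℕ) : ∀ c : ℕ → α,
      (∀ k < n, edist (g (c k)) (g (c (k + 1))) ≤ w (c k) + w (c (k + 1))) →
        edist (g (c 0)) (g (c n)) + w (c 0) ≤ 2 * ∑ a ∈ (Finset.range (n + 1)).image c, w a := by
  induction n using Nat.strong_induction_on with
  | _ n ih =>
    intro c hc
    -- All steps up to the last return to the starting point are skipped.
    obtain ⟨i, hin, hi, hlast⟩ : ∃ i ≤ n, c i = c 0 ∧ ∀ k, i < k → k ≤ n → c k ≠ c 0 :=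
      ⟨Nat.findGreatest (fun k => c k = c 0) n, Nat.findGreatest_le n,
        Nat.findGreatest_spec (P := fun k => c k = c 0) (Nat.zero_le n) rfl,
        fun k h1 h2 => Nat.findGreatest_is_greatest h1 h2⟩
    have hmem : c 0 ∈ (Finset.range (n + 1)).image c :=
      Finset.mem_image_of_mem c (by simp)
    rcases hin.eq_or_lt with rfl | hlt
    · rw [hi, edist_self, zero_add, two_mul]
      exact (Finset.single_le_sum (f := w) (fun _ _ => zero_le) hmem).trans le_self_add
    · obtain ⟨m, rfl⟩ : ∃ m, n = i + 1 + m := ⟨n - (i + 1), by omega⟩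
      have h1 := ih m (by omega) (fun k => c (i + 1 + k)) fun k hk => hc (i + 1 + k) (by omega)
      have h2 := hc i (by omega)
      rw [hi] at h2
      have hnot : c 0 ∉ (Finset.range (m + 1)).image fun k => c (i + 1 + k) := by
        intro h
        obtain ⟨k, hk, hk'⟩ := Finset.mem_image.1 h
        rw [Finset.mem_range] at hk
        exact hlast (i + 1 + k) (by omega) (by omega) hk'
      have hsub : insert (c 0) ((Finset.range (m + 1)).image fun k => c (i + 1 + k)) ⊆
          (Finset.range (i + 1 + m + 1)).image c := by
        refine Finset.insert_subset hmem fun a ha => ?_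
        obtain ⟨k, hk, rfl⟩ := Finset.mem_image.1 ha
        rw [Finset.mem_range] at hk
        exact Finset.mem_image_of_mem c (Finset.mem_range.2 (by omega))
      calc edist (g (c 0)) (g (c (i + 1 + m))) + w (c 0)
          ≤ edist (g (c 0)) (g (c (i + 1))) + edist (g (c (i + 1))) (g (c (i + 1 + m))) +
              w (c 0) := by
            gcongr
            exact edist_triangle _ _ _
        _ ≤ w (c 0) + w (c (i + 1)) + edist (g (c (i + 1))) (g (c (i + 1 + m))) + w (c 0) := by
            gcongr
        _ = 2 * w (c 0) + (edist (g (c (i + 1 + 0))) (g (c (i + 1 + m))) + w (c (i + 1 + 0))) := by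
            rw [add_zero]
            ring
        _ ≤ 2 * w (c 0) + 2 * ∑ a ∈ (Finset.range (m + 1)).image fun k => c (i + 1 + k), w a := by
            gcongr
        _ = 2 * ∑ a ∈ insert (c 0) ((Finset.range (m + 1)).image fun k => c (i + 1 + k)), w a := by
            rw [Finset.sum_insert hnot, mul_add]
        _ ≤ _ := by gcongr

section Far

variable {Ω : Set (EuclideanSpace ℝ (Fin d))} {W : Set (DyadicCube d)} {ε ρ s : ℝ} {q : ℝ≥0∞}
  {f : EuclideanSpace ℝ (Fin d) → ℂ} {u : W → EuclideanSpace ℝ (Fin d)}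

theorem enorm_sub_le_of_mem (hΩ : IsUniformDomainWith ε Ω W) (hρ : IsShadowParameter ε W ρ)
    (hs : 0 < s) (hq : 1 ≤ q) (hf : Measurable f) {Q : DyadicCube d} (hQ : Q ∈ W)
    {x y : EuclideanSpace ℝ (Fin d)} (hx : x ∈ Q.toSet) (hy : y ∈ Q.toSet) :
    ‖f x - f y‖ₑ ≤ ENNReal.ofReal (3 * √d) ^ (s + d / q.toReal) * ENNReal.ofReal Q.side ^ s *
      (innerNorm s q f (shadow W ρ Q) x + innerNorm s q f (shadow W ρ Q) y) := by
  have hself := subset_shadow (hΩ.mem_shadowCubes_self hρ hQ)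
  have hsq := Real.sqrt_nonneg d
  have hℓ := Q.side_pos
  refine (enorm_sub_le_innerNorm (C := 3 * √d) hs hq hf Q.measurableSet_toSet hℓ (by positivity)
    Q.volume_toSet.ge (fun z hz => (DyadicCube.dist_le hx hz).trans ?_)
    (fun z hz => (DyadicCube.dist_le hy hz).trans ?_)).trans ?_
  · nlinarith [mul_nonneg hsq hℓ.le]
  · nlinarith [mul_nonneg hsq hℓ.le]
  · gcongr
    · exact innerNorm_mono hq hself x
    · exact innerNorm_mono hq hself y

theorem enorm_sub_le_of_neighbors (hΩ : IsUniformDomainWith ε Ω W) (hε : 0 < ε)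
    (hρ : IsShadowParameter ε W ρ) (hs : 0 < s) (hq : 1 ≤ q) (hf : Measurable f)
    (hu : ∀ P : W, u P ∈ P.1.toSet) {P P' : W} (h : Neighbors P.1 P'.1) :
    ‖f (u P) - f (u P')‖ₑ ≤
      ENNReal.ofReal (3 * √d) ^ (s + d / q.toReal) * ENNReal.ofReal P.1.side ^ s *
        innerNorm s q f (shadow W ρ P) (u P) +
      ENNReal.ofReal (3 * √d) ^ (s + d / q.toReal) * ENNReal.ofReal P'.1.side ^ s *
        innerNorm s q f (shadow W ρ P') (u P') := by
  -- The smaller one of two neighbors lies in the shadow of both.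
  wlog hle : P'.1.side ≤ P.1.side generalizing P P'
  · rw [← edist_eq_enorm_sub, edist_comm, edist_eq_enorm_sub, add_comm]
    exact this h.symm (le_of_not_ge hle)
  have hself := subset_shadow (hΩ.mem_shadowCubes_self hρ P'.2)
  have hsub := subset_shadow (hΩ.neighbor_mem_shadowCubes hε hρ P.2 P'.2 h hle)
  have hsq := Real.sqrt_nonneg d
  have hℓ := P'.1.side_pos
  have h2 := hΩ.whitney.side_le_two_mul P.2 P'.2 h
  refine (enorm_sub_le_innerNorm (C := 3 * √d) hs hq hf P'.1.measurableSet_toSet hℓ (by positivity)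
    P'.1.volume_toSet.ge (fun z hz => (h.dist_le (hu P) hz).trans ?_)
    (fun z hz => (DyadicCube.dist_le (hu P') hz).trans ?_)).trans ?_
  · nlinarith
  · nlinarith [mul_nonneg hsq hℓ.le]
  · rw [mul_add]
    gcongr
    · exact innerNorm_mono hq hsub _
    · exact innerNorm_mono hq hself _

open Classical in
/-- Points `x` of `Q` and `y` of a Whitney cube that is not a neighbor of `Q` are connected through
the points `u P` of the cubes of the ascending part of an admissible chain. The shadow of each of
these cubes contains `Q`, and the shadow of the last one contains `y`. -/
theorem diffQuot_le_of_not_neighbors (hΩ : IsUniformDomainWith ε Ω W) (hε : 0 < ε)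
    (hρ : IsShadowParameter ε W ρ) (hs : 0 < s) (hq : 1 ≤ q) (hf : Measurable f)
    (hu : ∀ P : W, u P ∈ P.1.toSet) {Q S : W} (h : ¬ Neighbors Q.1 S.1)
    {x y : EuclideanSpace ℝ (Fin d)} (hx : x ∈ Q.1.toSet) (hy : y ∈ S.1.toSet) :
    diffQuot (s + d / q.toReal) f x y ≤
      ‖f x - f (u Q)‖ₑ * tailKernel (s + d / q.toReal) (ε / 5 * Q.1.side) x y +
      (∑' P : W, (if Q.1 ∈ shadowCubes W ρ P then
        2 * (ENNReal.ofReal (3 * √d) ^ (s + d / q.toReal) * ENNReal.ofReal P.1.side ^ s *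
          innerNorm s q f (shadow W ρ P) (u P)) else 0) *
            tailKernel (s + d / q.toReal) (ε / 5 * P.1.side) x y) +
      ∑' P : W, (if Q.1 ∈ shadowCubes W ρ P then
        ENNReal.ofReal ((√d + ρ) * (5 / ε)) ^ (s + d / q.toReal) else 0) *
          (shadow W ρ P.1).indicator (diffQuot (s + d / q.toReal) f (u P)) y := by
  set t := s + d / q.toReal with ht
  have htpos : 0 < t := by positivity
  set w : W → ℝ≥0∞ := fun P => ENNReal.ofReal (3 * √d) ^ t * ENNReal.ofReal P.1.side ^ s *
    innerNorm s q f (shadow W ρ P) (u P) with hw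
  have hD := hΩ.whitney.longDist_le_dist Q.2 S.2 h hx hy
  have hQd := hΩ.whitney.side_le_dist Q.2 S.2 h hx hy
  have hε2 := hΩ.le_half hε Q.2
  have hQp := Q.1.side_pos
  have hdist : 0 < dist x y := by linarith
  set K : ℝ≥0∞ := (‖x - y‖ₑ ^ t)⁻¹ with hK
  obtain ⟨n, c, j₀, hch⟩ := hΩ.exists_chain Q Q.2 S S.2
  obtain ⟨e, he, heW, hne, hsum⟩ := hch.exists_seq
  set e' : ℕ → W := fun k => ⟨e k, heW k⟩ with he'
  set m : ℕ := (j₀ : ℕ) with hm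
  have hmn : m < n := j₀.isLt
  have hmem : ∀ k ≤ m, Q.1 ∈ shadowCubes W ρ (e k) := by
    intro k hk
    have hkn : k < n + 1 := by omega
    have h1 := hρ.first_mem Q S n c j₀ hch ⟨k, hkn⟩ hk
    rwa [← he] at h1
  have hside : ∀ k ≤ m, ε / 5 * (e k).side ≤ dist x y := by
    intro k hk
    have h1 : (e k).side ≤ ∑ k ∈ Finset.range (n + 1), (e k).side :=
      Finset.single_le_sum (f := fun k => (e k).side) (fun k _ => (e k).side_pos.le)
        (Finset.mem_range.2 (by omega))
    have h2 : ε * (e k).side ≤ longDist Q.1 S.1 := by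
      have h3 := h1.trans hsum
      rw [one_div, inv_mul_eq_div, le_div_iff₀ hε] at h3
      linarith
    linarith
  have he0 : e' 0 = Q := Subtype.ext (by
    have := he 0
    rw [hch.first] at this
    exact this)
  -- The cubes in the ascending part of the chain.
  have hchain : ‖f (u Q) - f (u (e' m))‖ₑ * K ≤ ∑' P : W,
      (if Q.1 ∈ shadowCubes W ρ P then 2 * w P else 0) * tailKernel t (ε / 5 * P.1.side) x y := by
    have h1 := edist_add_le_two_mul_sum (fun P : W => f (u P)) w m e' fun k hk => by
      rw [edist_eq_enorm_sub]
      exact enorm_sub_le_of_neighbors hΩ hε hρ hs hq hf hu (hne k (by omega))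
    rw [he0, edist_eq_enorm_sub] at h1
    calc ‖f (u Q) - f (u (e' m))‖ₑ * K
        ≤ (2 * ∑ P ∈ (Finset.range (m + 1)).image e', w P) * K := by
          gcongr
          exact le_self_add.trans h1
      _ = ∑ P ∈ (Finset.range (m + 1)).image e', 2 * w P * K := by
          rw [Finset.mul_sum, Finset.sum_mul]
      _ = ∑ P ∈ (Finset.range (m + 1)).image e',
          (if Q.1 ∈ shadowCubes W ρ P then 2 * w P else 0) *
            tailKernel t (ε / 5 * P.1.side) x y := by
          refine Finset.sum_congr rfl fun P hP => ?_
          obtain ⟨k, hk, rfl⟩ := Finset.mem_image.1 hP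
          have hk' : k ≤ m := by
            rw [Finset.mem_range] at hk
            omega
          rw [if_pos (hmem k hk'), tailKernel, if_pos (hside k hk')]
      _ ≤ _ := ENNReal.sum_le_tsum _
  -- The central cube.
  have hcentral : ‖f (u (e' m)) - f y‖ₑ * K ≤ ∑' P : W, (if Q.1 ∈ shadowCubes W ρ P then
        ENNReal.ofReal ((√d + ρ) * (5 / ε)) ^ t else 0) *
          (shadow W ρ P.1).indicator (diffQuot t f (u P)) y := by
    refine le_trans ?_ (ENNReal.le_tsum (e' m))
    have hyS : y ∈ shadow W ρ (e m) := by
      have h1 := hρ.mem_central Q S n c j₀ hch (Fin.last n)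
      rw [hch.last, ← he] at h1
      exact subset_shadow h1 hy
    rw [if_pos (hmem m le_rfl), indicator_of_mem hyS]
    have hρ1 := hρ.one_lt
    have hA : 0 ≤ (√d + ρ) * (5 / ε) := by positivity
    have hclose : ‖u (e' m) - y‖ₑ ≤ ENNReal.ofReal ((√d + ρ) * (5 / ε)) * ‖x - y‖ₑ := by
      rw [← edist_eq_enorm_sub, ← edist_eq_enorm_sub, edist_dist, edist_dist,
        ← ENNReal.ofReal_mul hA]
      refine ENNReal.ofReal_le_ofReal ?_
      have h1 := DyadicCube.dist_le (hu (e' m)) (e m).center_mem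
      have h2 := dist_center_lt_of_mem_shadow hyS
      have h3 := dist_triangle_right (u (e' m)) y (e m).center
      have h4 : (e m).side ≤ 5 / ε * dist x y := by
        have h5 := hside m le_rfl
        rw [div_mul_eq_mul_div, le_div_iff₀ hε]
        linarith
      calc dist (u (e' m)) y ≤ (√d + ρ) * (e m).side := by linarith
        _ ≤ (√d + ρ) * (5 / ε * dist x y) := by gcongr
        _ = _ := by ring
    have hxy0 : ‖x - y‖ₑ ^ t ≠ 0 := by
      rw [Ne, ENNReal.rpow_eq_zero_iff_of_pos htpos, enorm_eq_zero, sub_eq_zero]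
      rintro rfl
      simp at hdist
    have hxyt : ‖x - y‖ₑ ^ t ≠ ∞ := ENNReal.rpow_ne_top_of_nonneg htpos.le enorm_ne_top
    calc ‖f (u (e' m)) - f y‖ₑ * K
        ≤ (ENNReal.ofReal ((√d + ρ) * (5 / ε)) * ‖x - y‖ₑ) ^ t *
            diffQuot t f (u (e' m)) y * K := by
          gcongr
          exact enorm_sub_le_diffQuot htpos _ _ hclose
      _ = ENNReal.ofReal ((√d + ρ) * (5 / ε)) ^ t * diffQuot t f (u (e' m)) y *
            (‖x - y‖ₑ ^ t * (‖x - y‖ₑ ^ t)⁻¹) := by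
          rw [ENNReal.mul_rpow_of_nonneg _ _ htpos.le]
          ring
      _ = _ := by rw [ENNReal.mul_inv_cancel hxy0 hxyt, mul_one]
  have hfirst : ‖f x - f (u Q)‖ₑ * K =
      ‖f x - f (u Q)‖ₑ * tailKernel t (ε / 5 * Q.1.side) x y := by
    rw [tailKernel, if_pos (by nlinarith)]
  calc diffQuot t f x y = ‖f x - f y‖ₑ * K := by rw [diffQuot, div_eq_mul_inv]
    _ ≤ (‖f x - f (u Q)‖ₑ + ‖f (u Q) - f (u (e' m))‖ₑ + ‖f (u (e' m)) - f y‖ₑ) * K := by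
        gcongr
        simp only [← edist_eq_enorm_sub]
        exact edist_triangle4 _ _ _ _
    _ ≤ _ := by
        rw [add_mul, add_mul, hfirst]
        gcongr

theorem innerNorm_iUnion_le {ι : Type*} [Countable ι] (hq : 1 ≤ q) (hf : Measurable f)
    {A : ι → Set (EuclideanSpace ℝ (Fin d))} (hA : ∀ i, MeasurableSet (A i))
    (x : EuclideanSpace ℝ (Fin d)) :
    innerNorm s q f (⋃ i, A i) x ≤ ∑' i, innerNorm s q f (A i) x := by
  have hm := measurable_diffQuot (t := s + d / q.toReal) hf x
  simp only [innerNorm_eq_eLpNorm hq]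
  calc _ ≤ eLpNorm (fun y => ∑' i, (A i).indicator (diffQuot (s + d / q.toReal) f x) y) q
        volume := by
        rw [← eLpNorm_indicator_eq_eLpNorm_restrict (MeasurableSet.iUnion hA)]
        refine eLpNorm_mono_enorm fun y => ?_
        simp only [enorm_eq_self]
        by_cases hy : y ∈ ⋃ i, A i
        · obtain ⟨i, hi⟩ := mem_iUnion.1 hy
          rw [indicator_of_mem hy]
          refine le_trans (le_of_eq ?_) (ENNReal.le_tsum i)
          rw [indicator_of_mem hi]
        · rw [indicator_of_notMem hy]
          exact zero_le
    _ ≤ _ := by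
        refine (eLpNorm_tsum_ennreal_le hq fun i => hm.indicator (hA i)).trans (le_of_eq ?_)
        simp_rw [eLpNorm_indicator_eq_eLpNorm_restrict (hA _)]

theorem innerNorm_union_le (hq : 1 ≤ q) (hf : Measurable f)
    {A B : Set (EuclideanSpace ℝ (Fin d))} (hA : MeasurableSet A) (hB : MeasurableSet B)
    (x : EuclideanSpace ℝ (Fin d)) :
    innerNorm s q f (A ∪ B) x ≤ innerNorm s q f A x + innerNorm s q f B x := by
  rw [union_eq_iUnion]
  refine (innerNorm_iUnion_le hq hf (fun b => ?_) x).trans ?_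
  · cases b <;> assumption
  · rw [tsum_bool, add_comm]
    rfl

open Classical in
/-- The part of the inner norm over the distant cubes is controlled by inner norms over shadows,
where each cube `P` whose shadow contains `Q` enters with a single point `u P`. -/
theorem exists_innerNorm_far_le (d : ℕ) {ε : ℝ} (hε : 0 < ε) (ρ : ℝ) (hs : 0 < s) (hq : 1 ≤ q) :
    ∃ C : ℝ≥0, ∀ (Ω : Set (EuclideanSpace ℝ (Fin d))) (W : Set (DyadicCube d)),
      IsUniformDomainWith ε Ω W → IsShadowParameter ε W ρ →
      ∀ f : EuclideanSpace ℝ (Fin d) → ℂ, Measurable f →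
      ∀ u : W → EuclideanSpace ℝ (Fin d), (∀ P : W, u P ∈ P.1.toSet) →
      ∀ Q : W, ∀ x ∈ Q.1.toSet,
        innerNorm s q f (⋃ S ∈ {S ∈ W | ¬ Neighbors Q.1 S}, S.toSet) x ≤
          C * (innerNorm s q f (shadow W ρ Q) x + ∑' P : W, if Q.1 ∈ shadowCubes W ρ P then
            innerNorm s q f (shadow W ρ P) (u P) else 0) := by
  obtain ⟨C₁, hC₁⟩ := exists_eLpNorm_tailKernel_le d hs hq
  set t := s + d / q.toReal with ht
  have htpos : 0 < t := by positivity
  set A : ℝ≥0∞ := ENNReal.ofReal (3 * √d) ^ t with hA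
  set B : ℝ≥0∞ := ENNReal.ofReal ((√d + ρ) * (5 / ε)) ^ t with hB
  set D : ℝ≥0∞ := A * C₁ * ENNReal.ofReal (ε / 5) ^ (-s) with hD
  have hAt : A ≠ ∞ := ENNReal.rpow_ne_top_of_nonneg htpos.le ENNReal.ofReal_ne_top
  have hBt : B ≠ ∞ := ENNReal.rpow_ne_top_of_nonneg htpos.le ENNReal.ofReal_ne_top
  have hε5 : ENNReal.ofReal (ε / 5) ≠ 0 := by simpa using hε
  have hDt : D ≠ ∞ := ENNReal.mul_ne_top (ENNReal.mul_ne_top hAt ENNReal.coe_ne_top) (by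
    simp [ENNReal.rpow_eq_top_iff, (div_pos hε (by norm_num : (0 : ℝ) < 5)).not_ge])
  have hne : D + 2 * D + B ≠ ∞ := by
    simp [ENNReal.add_eq_top, ENNReal.mul_eq_top, hDt, hBt]
  refine ⟨(D + 2 * D + B).toNNReal, fun Ω W hΩ hρ f hf u hu Q x hx => ?_⟩
  rw [ENNReal.coe_toNNReal hne]
  set b : W → ℝ≥0∞ := fun P => innerNorm s q f (shadow W ρ P) (u P) with hb
  set N := innerNorm s q f (shadow W ρ Q) x with hN
  set β := ∑' P : W, (if Q.1 ∈ shadowCubes W ρ P then b P else 0) with hβ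
  have hbQ : b Q ≤ β := by
    refine le_trans (le_of_eq ?_) (ENNReal.le_tsum Q)
    rw [if_pos (hΩ.mem_shadowCubes_self hρ Q.2)]
  have hmK : ∀ r, Measurable (tailKernel t r x) := fun r => measurable_tailKernel t r x
  have hmd : ∀ P : W, Measurable ((shadow W ρ P.1).indicator (diffQuot t f (u P))) := fun P =>
    (measurable_diffQuot hf _).indicator (measurableSet_shadow _)
  -- The weight `ℓ(P) ^ s` compensates the norm of the kernel that is cut off at the scale `ℓ(P)`.
  have hcomp : ∀ P : DyadicCube d, A * ENNReal.ofReal P.side ^ s *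
      eLpNorm (tailKernel t (ε / 5 * P.side) x) q volume ≤ D := by
    intro P
    have hP := P.side_pos
    have hP0 : ENNReal.ofReal P.side ≠ 0 := by simpa using hP
    calc _ ≤ A * ENNReal.ofReal P.side ^ s * (C₁ * ENNReal.ofReal (ε / 5 * P.side) ^ (-s)) := by
          gcongr
          exact hC₁ x _ (by positivity)
      _ = D * (ENNReal.ofReal P.side ^ s * ENNReal.ofReal P.side ^ (-s)) := by
          rw [ENNReal.ofReal_mul (by positivity), ENNReal.mul_rpow_of_ne_zero hε5 hP0]
          ring
      _ = D := by
          rw [← ENNReal.rpow_add _ _ hP0 ENNReal.ofReal_ne_top, add_neg_cancel, ENNReal.rpow_zero,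
            mul_one]
  set g₁ : EuclideanSpace ℝ (Fin d) → ℝ≥0∞ := fun y =>
    ‖f x - f (u Q)‖ₑ * tailKernel t (ε / 5 * Q.1.side) x y with hg₁
  set g₂ : W → EuclideanSpace ℝ (Fin d) → ℝ≥0∞ := fun P y => (if Q.1 ∈ shadowCubes W ρ P then
    2 * (A * ENNReal.ofReal P.1.side ^ s * b P) else 0) * tailKernel t (ε / 5 * P.1.side) x y
    with hg₂
  set g₃ : W → EuclideanSpace ℝ (Fin d) → ℝ≥0∞ := fun P y => (if Q.1 ∈ shadowCubes W ρ P then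
    B else 0) * (shadow W ρ P.1).indicator (diffQuot t f (u P)) y with hg₃
  have hm₁ : Measurable g₁ := (hmK _).const_mul _
  have hm₂ : ∀ P, Measurable (g₂ P) := fun P => (hmK _).const_mul _
  have hm₃ : ∀ P, Measurable (g₃ P) := fun P => (hmd P).const_mul _
  have h₁ : eLpNorm g₁ q volume ≤ D * N + D * β := by
    rw [hg₁, eLpNorm_const_mul_ennreal hq _ (hmK _)]
    calc _ ≤ A * ENNReal.ofReal Q.1.side ^ s * (N + b Q) *
          eLpNorm (tailKernel t (ε / 5 * Q.1.side) x) q volume := by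
          gcongr
          exact enorm_sub_le_of_mem hΩ hρ hs hq hf Q.2 hx (hu Q)
      _ = A * ENNReal.ofReal Q.1.side ^ s *
          eLpNorm (tailKernel t (ε / 5 * Q.1.side) x) q volume * (N + b Q) := by ring
      _ ≤ D * (N + β) := by
          gcongr
          exact hcomp Q
      _ = _ := mul_add _ _ _
  have h₂ : ∑' P, eLpNorm (g₂ P) q volume ≤ 2 * D * β := by
    rw [hβ, ← ENNReal.tsum_mul_left]
    refine ENNReal.tsum_le_tsum fun P => ?_
    simp only [hg₂]
    rw [eLpNorm_const_mul_ennreal hq _ (hmK _)]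
    split_ifs
    · calc _ = 2 * (A * ENNReal.ofReal P.1.side ^ s *
            eLpNorm (tailKernel t (ε / 5 * P.1.side) x) q volume) * b P := by ring
        _ ≤ _ := by
            gcongr
            exact hcomp P
    · simp
  have h₃ : ∑' P, eLpNorm (g₃ P) q volume ≤ B * β := by
    rw [hβ, ← ENNReal.tsum_mul_left]
    refine ENNReal.tsum_le_tsum fun P => ?_
    simp only [hg₃]
    rw [eLpNorm_const_mul_ennreal hq _ (hmd P),
      eLpNorm_indicator_eq_eLpNorm_restrict (measurableSet_shadow _), ← innerNorm_eq_eLpNorm hq]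
    split_ifs
    · exact le_rfl
    · simp
  have hmeas : MeasurableSet (⋃ S ∈ {S ∈ W | ¬ Neighbors Q.1 S}, S.toSet) :=
    (isOpen_biUnion fun S _ => S.isOpen_toSet).measurableSet
  calc innerNorm s q f (⋃ S ∈ {S ∈ W | ¬ Neighbors Q.1 S}, S.toSet) x
      ≤ eLpNorm (g₁ + (fun y => ∑' P, g₂ P y) + fun y => ∑' P, g₃ P y) q
          (volume.restrict (⋃ S ∈ {S ∈ W | ¬ Neighbors Q.1 S}, S.toSet)) := by
        rw [innerNorm_eq_eLpNorm hq]
        refine eLpNorm_mono_enorm_ae ?_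
        filter_upwards [ae_restrict_mem hmeas] with y hy
        simp only [mem_iUnion] at hy
        obtain ⟨S, hS, hy⟩ := hy
        exact diffQuot_le_of_not_neighbors hΩ hε hρ hs hq hf hu (S := ⟨S, hS.1⟩) hS.2 hx hy
    _ ≤ eLpNorm (g₁ + (fun y => ∑' P, g₂ P y) + fun y => ∑' P, g₃ P y) q volume :=
        eLpNorm_mono_measure _ Measure.restrict_le_self
    _ ≤ eLpNorm g₁ q volume + eLpNorm (fun y => ∑' P, g₂ P y) q volume +
          eLpNorm (fun y => ∑' P, g₃ P y) q volume := by
        have hms₂ : Measurable fun y => ∑' P, g₂ P y := Measurable.tsum hm₂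
        have hms₃ : Measurable fun y => ∑' P, g₃ P y := Measurable.tsum hm₃
        refine (eLpNorm_add_le (hm₁.add hms₂).aestronglyMeasurable
          hms₃.aestronglyMeasurable hq).trans ?_
        gcongr
        exact eLpNorm_add_le hm₁.aestronglyMeasurable hms₂.aestronglyMeasurable hq
    _ ≤ (D * N + D * β) + 2 * D * β + B * β := by
        gcongr
        · exact (eLpNorm_tsum_ennreal_le hq hm₂).trans h₂
        · exact (eLpNorm_tsum_ennreal_le hq hm₃).trans h₃
    _ ≤ (D * N + D * β) + 2 * D * β + B * β + (2 * D * N + B * N) := le_self_add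
    _ = _ := by ring

end Far

/-! ### Comparison of the seminorms -/

section Comparison

variable {Ω : Set (EuclideanSpace ℝ (Fin d))} {W : Set (DyadicCube d)} {ε ρ s p : ℝ} {q : ℝ≥0∞}
  {f : EuclideanSpace ℝ (Fin d) → ℂ}

theorem IsWhitneyCovering.pairwise_disjoint (hW : IsWhitneyCovering Ω W) :
    Pairwise (Function.onFun Disjoint fun Q : W => Q.1.toSet) := fun Q S h =>
  hW.disjoint Q Q.2 S S.2 fun h' => h (Subtype.ext h')

theorem IsWhitneyCovering.iUnion_ae_eq (hW : IsWhitneyCovering Ω W) :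
    (⋃ Q : W, Q.1.toSet) =ᵐ[volume] Ω := by
  have h : Ω = ⋃ Q : W, closure Q.1.toSet := by rw [← hW.cover, biUnion_eq_iUnion]
  rw [h]
  refine Filter.EventuallyEq.countable_iUnion fun Q => ?_
  exact (subset_closure.eventuallyLE).antisymm (ae_le_set.2 Q.1.volume_closure_diff)

theorem IsWhitneyCovering.lintegral_eq_tsum (hW : IsWhitneyCovering Ω W)
    (g : EuclideanSpace ℝ (Fin d) → ℝ≥0∞) :
    ∫⁻ x in Ω, g x = ∑' Q : W, ∫⁻ x in Q.1.toSet, g x := by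
  rw [← setLIntegral_congr hW.iUnion_ae_eq,
    lintegral_iUnion (fun Q : W => Q.1.measurableSet_toSet) hW.pairwise_disjoint]

theorem shadowSeminorm_le_fullSeminorm (hW : IsWhitneyCovering Ω W) (hp : 1 ≤ p) (hq : 1 ≤ q) :
    shadowSeminorm s p q W ρ f ≤ fullSeminorm s p q Ω f := by
  unfold shadowSeminorm fullSeminorm
  rw [hW.lintegral_eq_tsum]
  gcongr with Q x
  exact innerNorm_mono hq (hW.shadow_subset _) x

theorem fullSeminorm_congr {g : EuclideanSpace ℝ (Fin d) → ℂ} (h : f =ᵐ[volume.restrict Ω] g) :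
    fullSeminorm s p q Ω f = fullSeminorm s p q Ω g := by
  unfold fullSeminorm
  congr 1
  refine lintegral_congr_ae ?_
  filter_upwards [h] with x hx
  rw [innerNorm_congr h hx]

theorem shadowSeminorm_congr (hW : IsWhitneyCovering Ω W) {g : EuclideanSpace ℝ (Fin d) → ℂ}
    (h : f =ᵐ[volume.restrict Ω] g) :
    shadowSeminorm s p q W ρ f = shadowSeminorm s p q W ρ g := by
  unfold shadowSeminorm
  congr 1
  refine tsum_congr fun Q => lintegral_congr_ae ?_
  filter_upwards [ae_mono (Measure.restrict_mono (hW.subset Q.2) le_rfl) h] with x hx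
  rw [innerNorm_congr (ae_mono (Measure.restrict_mono (hW.shadow_subset _) le_rfl) h) hx]

/-- The neighbors of `Q` that are not contained in its shadow. They have twice the size of `Q`. -/
def IsOuterNeighbor (W : Set (DyadicCube d)) (ρ : ℝ) (Q S : DyadicCube d) : Prop :=
  Neighbors Q S ∧ S ∉ shadowCubes W ρ Q

theorem IsOuterNeighbor.scale_eq (hΩ : IsUniformDomainWith ε Ω W) (hε : 0 < ε)
    (hρ : IsShadowParameter ε W ρ) {Q S : DyadicCube d} (hQ : Q ∈ W) (hS : S ∈ W)
    (h : IsOuterNeighbor W ρ Q S) : S.scale = Q.scale + 1 := by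
  have h1 : ¬ S.side ≤ Q.side := fun h' => h.2 (hΩ.neighbor_mem_shadowCubes hε hρ hQ hS h.1 h')
  rw [DyadicCube.side_le_side_iff] at h1
  have h2 := hΩ.whitney.side_le_two_mul hS hQ h.1.symm
  have h3 : S.side ≤ (⟨Q.scale + 1, Q.index⟩ : DyadicCube d).side := by
    rw [DyadicCube.side_eq_pow_mul (Q := Q) (R := ⟨Q.scale + 1, Q.index⟩) (j := 1) rfl, pow_one]
    exact h2
  have h4 := DyadicCube.side_le_side_iff.1 h3
  simp only at h4
  omega

theorem IsOuterNeighbor.mem_shadowCubes (hΩ : IsUniformDomainWith ε Ω W) (hε : 0 < ε)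
    (hρ : IsShadowParameter ε W ρ) {Q S : DyadicCube d} (hQ : Q ∈ W) (hS : S ∈ W)
    (h : IsOuterNeighbor W ρ Q S) : Q ∈ shadowCubes W ρ S :=
  hΩ.neighbor_mem_shadowCubes hε hρ hS hQ h.1.symm
    (le_of_not_ge fun h' => h.2 (hΩ.neighbor_mem_shadowCubes hε hρ hQ hS h.1 h'))

open Classical in
/-- The numbers of outer neighbors are bounded, in both directions. -/
theorem exists_tsum_isOuterNeighbor_le (d : ℕ) {ε : ℝ} (hε : 0 < ε) (ρ : ℝ) :
    ∃ M : ℕ, ∀ (Ω : Set (EuclideanSpace ℝ (Fin d))) (W : Set (DyadicCube d)),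
      IsUniformDomainWith ε Ω W → IsShadowParameter ε W ρ → ∀ R : W,
        (∑' S : W, (if IsOuterNeighbor W ρ R S then (1 : ℝ≥0∞) else 0) ≤ M) ∧
          ∑' Q : W, (if IsOuterNeighbor W ρ Q R then (1 : ℝ≥0∞) else 0) ≤ M := by
  obtain ⟨M, hM⟩ := exists_card_near_le d 3
  have hcount : ∀ (W : Set (DyadicCube d)) (k : ℤ) (z : EuclideanSpace ℝ (Fin d)) (B : W → Prop),
      (∀ P : W, B P → P.1.scale = k ∧ ∀ i, |P.1.center i - z i| ≤ 3 * P.1.side) →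
      ∑' P : W, (if B P then (1 : ℝ≥0∞) else 0) ≤ M := by
    intro W k z B hB
    obtain ⟨F, hF, hmem⟩ := hM k z
    calc ∑' P : W, (if B P then (1 : ℝ≥0∞) else 0)
        ≤ ∑' P : W, (if P.1 ∈ F then (1 : ℝ≥0∞) else 0) := by
          refine ENNReal.tsum_le_tsum fun P => ?_
          by_cases hP : B P
          · rw [if_pos hP, if_pos (hmem P (hB P hP).1 (hB P hP).2)]
          · rw [if_neg hP]
            exact zero_le
      _ ≤ F.card * 1 := tsum_ite_mem_le Subtype.val_injective F 1
      _ ≤ M := by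
          rw [mul_one]
          exact_mod_cast hF
  refine ⟨M, fun Ω W hΩ hρ R => ⟨?_, ?_⟩⟩
  · refine hcount W (R.1.scale + 1) R.1.center _ fun S hS => ?_
    have h1 := hS.scale_eq hΩ hε hρ R.2 S.2
    refine ⟨h1, fun i => ?_⟩
    have h2 := hS.1.symm.abs_sub_le S.1.center_mem R.1.center_mem i
    have h3 := DyadicCube.side_eq_pow_mul (Q := R.1) (R := S.1) (j := 1) h1.symm
    have := R.1.side_pos
    linarith
  · refine hcount W (R.1.scale - 1) R.1.center _ fun Q hQ => ?_
    have h1 := hQ.scale_eq hΩ hε hρ Q.2 R.2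
    refine ⟨by omega, fun i => ?_⟩
    have h2 := hQ.1.abs_sub_le Q.1.center_mem R.1.center_mem i
    have h3 := DyadicCube.side_eq_pow_mul (Q := Q.1) (R := R.1) (j := 1) h1.symm
    linarith

open Classical in
/-- The inner norm over the whole domain splits into the parts over the shadow, over the outer
neighbors and over the distant cubes. -/
theorem innerNorm_le_add_add (hW : IsWhitneyCovering Ω W) (hq : 1 ≤ q) (hf : Measurable f) (Q : W)
    (x : EuclideanSpace ℝ (Fin d)) :
    innerNorm s q f Ω x ≤ innerNorm s q f (shadow W ρ Q) x +
      (∑' S : W, if IsOuterNeighbor W ρ Q S then innerNorm s q f S.1.toSet x else 0) +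
      innerNorm s q f (⋃ S ∈ {S ∈ W | ¬ Neighbors Q.1 S}, S.toSet) x := by
  have hΩ : innerNorm s q f Ω x = innerNorm s q f (⋃ S : W, S.1.toSet) x := by
    rw [innerNorm_eq_eLpNorm hq, innerNorm_eq_eLpNorm hq,
      Measure.restrict_congr_set hW.iUnion_ae_eq]
  set A : W → Set (EuclideanSpace ℝ (Fin d)) := fun S =>
    if IsOuterNeighbor W ρ Q S then S.1.toSet else ∅ with hA
  have hAm : ∀ S, MeasurableSet (A S) := fun S => by
    simp only [hA]
    split_ifs
    · exact S.1.measurableSet_toSet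
    · exact MeasurableSet.empty
  have hsub : (⋃ S : W, S.1.toSet) ⊆
      (shadow W ρ Q ∪ ⋃ S : W, A S) ∪ ⋃ S ∈ {S ∈ W | ¬ Neighbors Q.1 S}, S.toSet := by
    refine iUnion_subset fun S y hy => ?_
    by_cases h1 : S.1 ∈ shadowCubes W ρ Q
    · exact Or.inl (Or.inl (subset_shadow h1 hy))
    by_cases h2 : Neighbors Q.1 S.1
    · refine Or.inl (Or.inr (mem_iUnion.2 ⟨S, ?_⟩))
      simp only [hA]
      rwa [if_pos ⟨h2, h1⟩]
    · exact Or.inr (mem_iUnion₂.2 ⟨S, ⟨S.2, h2⟩, hy⟩)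
  have hfar : MeasurableSet (⋃ S ∈ {S ∈ W | ¬ Neighbors Q.1 S}, S.toSet) :=
    (isOpen_biUnion fun S _ => S.isOpen_toSet).measurableSet
  rw [hΩ]
  refine (innerNorm_mono hq hsub x).trans ((innerNorm_union_le hq hf
    ((measurableSet_shadow _).union (MeasurableSet.iUnion hAm)) hfar x).trans ?_)
  gcongr
  refine (innerNorm_union_le hq hf (measurableSet_shadow _) (MeasurableSet.iUnion hAm) x).trans ?_
  gcongr
  refine (innerNorm_iUnion_le hq hf hAm x).trans (ENNReal.tsum_le_tsum fun S => ?_)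
  simp only [hA]
  split_ifs
  · exact le_rfl
  · rw [innerNorm_eq_eLpNorm hq]
    simp

/-- Every cube contains a point at which the inner norm over the shadow is at most its average. -/
theorem exists_mem_volume_mul_innerNorm_le (hf : Measurable f) (P : DyadicCube d)
    (A : Set (EuclideanSpace ℝ (Fin d))) : ∃ u ∈ P.toSet,
      volume P.toSet * innerNorm s q f A u ^ p ≤ ∫⁻ x in P.toSet, innerNorm s q f A x ^ p := by
  have h0 : volume P.toSet ≠ 0 := by
    rw [P.volume_toSet]
    exact pow_ne_zero _ (by simpa using P.side_pos)
  have ht : volume P.toSet ≠ ∞ := by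
    rw [P.volume_toSet]
    exact ENNReal.pow_ne_top ENNReal.ofReal_ne_top
  obtain ⟨u, hu, hle⟩ := exists_le_setLAverage h0 ht
    ((measurable_innerNorm (s := s) (q := q) hf A).pow_const p).aemeasurable
  refine ⟨u, hu, ?_⟩
  rw [setLAverage_eq] at hle
  calc _ ≤ volume P.toSet * ((∫⁻ x in P.toSet, innerNorm s q f A x ^ p) / volume P.toSet) := by
        gcongr
    _ = _ := ENNReal.mul_div_cancel h0 ht

theorem add_add_rpow_le {p : ℝ} (hp : 1 ≤ p) (a b c : ℝ≥0∞) :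
    (a + b + c) ^ p ≤ 4 ^ p * (a ^ p + b ^ p + c ^ p) := by
  have h2 : ∀ a b : ℝ≥0∞, (a + b) ^ p ≤ 2 ^ p * (a ^ p + b ^ p) := fun a b =>
    (ENNReal.rpow_add_le_mul_rpow_add_rpow a b hp).trans (by
      gcongr
      · exact one_le_two
      · linarith)
  have h1 : (1 : ℝ≥0∞) ≤ 2 ^ p := ENNReal.one_le_rpow one_le_two (by linarith)
  calc (a + b + c) ^ p ≤ 2 ^ p * ((a + b) ^ p + c ^ p) := h2 _ _
    _ ≤ 2 ^ p * (2 ^ p * (a ^ p + b ^ p) + 2 ^ p * c ^ p) := by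
        gcongr
        · exact h2 _ _
        · exact le_mul_of_one_le_left' h1
    _ = (2 * 2) ^ p * (a ^ p + b ^ p + c ^ p) := by
        rw [ENNReal.mul_rpow_of_nonneg _ _ (by linarith)]
        ring
    _ = _ := by norm_num

open Classical in
/-- The `p`-th powers of the seminorms, for measurable `f`: the pointwise bounds on the three parts of
the inner norm are integrated over the Whitney cubes and summed up. -/
theorem exists_lintegral_innerNorm_le (hd : 1 ≤ d) (hε : 0 < ε) (ρ : ℝ) (hs : 0 < s) (hp : 1 ≤ p)
    (hq : 1 ≤ q) : ∃ C : ℝ≥0, ∀ (Ω : Set (EuclideanSpace ℝ (Fin d))) (W : Set (DyadicCube d)),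
      IsUniformDomainWith ε Ω W → IsShadowParameter ε W ρ →
      ∀ f : EuclideanSpace ℝ (Fin d) → ℂ, Measurable f →
        ∫⁻ x in Ω, innerNorm s q f Ω x ^ p ≤
          C * ∑' Q : W, ∫⁻ x in Q.1.toSet, innerNorm s q f (shadow W ρ Q.1) x ^ p := by
  have hp0 : 0 ≤ p := by linarith
  obtain ⟨C₁, hC₁⟩ := exists_innerNorm_far_le d hε ρ hs hq
  obtain ⟨C₂, hC₂⟩ := exists_innerNorm_neighbor_le d hs hq
  obtain ⟨C₃, hC₃⟩ := exists_tsum_rpow_tsum_shadow_le hd hε ρ hp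
  obtain ⟨M, hM⟩ := exists_tsum_isOuterNeighbor_le d hε ρ
  set K : ℝ≥0 := 1 + C₂ * M + C₂ + C₁ with hK
  refine ⟨K ^ p * 4 ^ p * (1 + (M : ℝ≥0) ^ (p - 1) * M + C₃), fun Ω W hΩ hρ f hf => ?_⟩
  have hW := hΩ.whitney
  -- The points `u P` are such that the inner norm is not larger than its average.
  choose u hu hub using fun P : W =>
    exists_mem_volume_mul_innerNorm_le (s := s) (p := p) (q := q) hf P.1 (shadow W ρ P.1)
  set N : W → EuclideanSpace ℝ (Fin d) → ℝ≥0∞ := fun P => innerNorm s q f (shadow W ρ P.1) with hN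
  have hNm : ∀ P, Measurable fun x => N P x ^ p := fun P => (measurable_innerNorm hf _).pow_const p
  set X : W → ℝ≥0∞ := fun P => ∫⁻ x in P.1.toSet, N P x ^ p with hX
  have hrefl : ∀ Q S : W, IsOuterNeighbor W ρ Q S →
      ∃ T : EuclideanSpace ℝ (Fin d) → EuclideanSpace ℝ (Fin d), MeasurePreserving T ∧
        (∀ x ∈ Q.1.toSet, T x ∈ S.1.toSet) ∧
        ∀ x ∈ Q.1.toSet, innerNorm s q f S.1.toSet x ≤ C₂ * (N Q x + N S (T x)) := by
    intro Q S h
    have hscale := h.scale_eq hΩ hε hρ Q.2 S.2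
    obtain ⟨T, hT, hTS, hTx⟩ := hC₂ Q.1 S.1 h.1 hscale (hW.disjoint _ Q.2 _ S.2 (by
      intro h'
      rw [h'] at hscale
      omega))
    refine ⟨T, hT, hTS, fun x hx => (hTx f hf x hx).trans ?_⟩
    gcongr
    · exact innerNorm_mono hq (subset_shadow (hΩ.mem_shadowCubes_self hρ Q.2)) x
    · exact innerNorm_mono hq (union_subset
        (subset_shadow (h.mem_shadowCubes hΩ hε hρ Q.2 S.2))
        (subset_shadow (hΩ.mem_shadowCubes_self hρ S.2))) _
  choose! T hTm hTS hTx using hrefl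
  set β : W → ℝ≥0∞ := fun Q => ∑' P : W, if Q.1 ∈ shadowCubes W ρ P then N P (u P) else 0 with hβ
  set ν : W → EuclideanSpace ℝ (Fin d) → ℝ≥0∞ := fun Q x =>
    ∑' S : W, if IsOuterNeighbor W ρ Q S then N S (T Q S x) else 0 with hν
  have hpt : ∀ Q : W, ∀ x ∈ Q.1.toSet, innerNorm s q f Ω x ≤ K * (N Q x + ν Q x + β Q) := by
    intro Q x hx
    have h1 : (∑' S : W, if IsOuterNeighbor W ρ Q S then innerNorm s q f S.1.toSet x else 0) ≤
        C₂ * M * N Q x + C₂ * ν Q x := by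
      calc _ ≤ ∑' S : W, (C₂ * N Q x * (if IsOuterNeighbor W ρ Q S then 1 else 0) +
            C₂ * if IsOuterNeighbor W ρ Q S then N S (T Q S x) else 0) := by
            refine ENNReal.tsum_le_tsum fun S => ?_
            split_ifs with h
            · rw [mul_one, ← mul_add]
              exact hTx Q S h x hx
            · simp
        _ = C₂ * N Q x * (∑' S : W, if IsOuterNeighbor W ρ Q S then 1 else 0) + C₂ * ν Q x := by
            rw [ENNReal.tsum_add, ENNReal.tsum_mul_left, ENNReal.tsum_mul_left]
        _ ≤ C₂ * N Q x * M + C₂ * ν Q x := by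
            gcongr
            exact (hM Ω W hΩ hρ Q).1
        _ = _ := by ring
    calc innerNorm s q f Ω x
        ≤ N Q x + (C₂ * M * N Q x + C₂ * ν Q x) + C₁ * (N Q x + β Q) :=
          (innerNorm_le_add_add (ρ := ρ) hW hq hf Q x).trans
            (add_le_add (add_le_add le_rfl h1) (hC₁ Ω W hΩ hρ f hf u hu Q x hx))
      _ ≤ N Q x + (C₂ * M * N Q x + C₂ * ν Q x) + C₁ * (N Q x + β Q) +
          (C₂ * N Q x + (1 + C₂ * M + C₁) * ν Q x + (1 + C₂ * M + C₂) * β Q) := le_self_add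
      _ = _ := by
          rw [hK]
          push_cast
          ring
  have hνp : ∀ Q x, ν Q x ^ p ≤
      M ^ (p - 1) * ∑' S : W, if IsOuterNeighbor W ρ Q S then N S (T Q S x) ^ p else 0 := by
    intro Q x
    have h1 := tsum_mul_le_rpow hp (fun S : W => if IsOuterNeighbor W ρ Q S then (1 : ℝ≥0∞) else 0)
      fun S => N S (T Q S x)
    simp only [ite_mul, one_mul, zero_mul] at h1
    refine h1.trans ?_
    gcongr
    exact (hM Ω W hΩ hρ Q).1
  have hint : ∀ Q : W, ∫⁻ x in Q.1.toSet, innerNorm s q f Ω x ^ p ≤ K ^ p * 4 ^ p * (X Q +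
      M ^ (p - 1) * (∑' S : W, if IsOuterNeighbor W ρ Q S then X S else 0) +
      volume Q.1.toSet * β Q ^ p) := by
    intro Q
    have hterm : ∀ S : W, Measurable fun x =>
        if IsOuterNeighbor W ρ Q S then N S (T Q S x) ^ p else 0 := by
      intro S
      split_ifs with h
      · exact (hNm S).comp (hTm Q S h).measurable
      · exact measurable_const
    calc ∫⁻ x in Q.1.toSet, innerNorm s q f Ω x ^ p
        ≤ ∫⁻ x in Q.1.toSet, K ^ p * 4 ^ p * (N Q x ^ p + M ^ (p - 1) *
            (∑' S : W, if IsOuterNeighbor W ρ Q S then N S (T Q S x) ^ p else 0) + β Q ^ p) := by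
          refine setLIntegral_mono' Q.1.measurableSet_toSet fun x hx => ?_
          calc innerNorm s q f Ω x ^ p ≤ (K * (N Q x + ν Q x + β Q)) ^ p := by
                gcongr
                exact hpt Q x hx
            _ ≤ K ^ p * (4 ^ p * (N Q x ^ p + ν Q x ^ p + β Q ^ p)) := by
                rw [ENNReal.mul_rpow_of_nonneg _ _ hp0]
                gcongr
                exact add_add_rpow_le hp _ _ _
            _ ≤ _ := by
                rw [mul_assoc]
                gcongr
                exact hνp Q x
      _ = K ^ p * 4 ^ p * (X Q + M ^ (p - 1) * (∑' S : W, ∫⁻ x in Q.1.toSet,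
            if IsOuterNeighbor W ρ Q S then N S (T Q S x) ^ p else 0) +
            volume Q.1.toSet * β Q ^ p) := by
          have hsm : Measurable fun x => ∑' S : W,
            if IsOuterNeighbor W ρ Q S then N S (T Q S x) ^ p else 0 := Measurable.tsum hterm
          have hall : Measurable fun x => N Q x ^ p + M ^ (p - 1) * (∑' S : W,
              if IsOuterNeighbor W ρ Q S then N S (T Q S x) ^ p else 0) + β Q ^ p :=
            ((hNm Q).add (hsm.const_mul _)).add measurable_const
          rw [lintegral_const_mul _ hall,
            lintegral_add_right _ measurable_const, lintegral_add_left (hNm Q),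
            lintegral_const_mul _ hsm, lintegral_tsum fun S => (hterm S).aemeasurable,
            setLIntegral_const, mul_comm (volume Q.1.toSet)]
      _ ≤ _ := by
          gcongr with S
          split_ifs with h
          · rw [← lintegral_indicator Q.1.measurableSet_toSet, hX]
            simp only
            rw [← lintegral_indicator S.1.measurableSet_toSet,
              ← (hTm Q S h).lintegral_comp ((hNm S).indicator S.1.measurableSet_toSet)]
            refine lintegral_mono fun x => ?_
            by_cases hx : x ∈ Q.1.toSet
            · rw [indicator_of_mem hx, indicator_of_mem (hTS Q S h x hx)]
            · rw [indicator_of_notMem hx]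
              exact zero_le
          · simp
  have hsum₂ : ∑' Q : W, ∑' S : W, (if IsOuterNeighbor W ρ Q S then X S else 0) ≤
      M * ∑' Q : W, X Q := by
    rw [ENNReal.tsum_comm, ← ENNReal.tsum_mul_left]
    refine ENNReal.tsum_le_tsum fun S => ?_
    calc ∑' Q : W, (if IsOuterNeighbor W ρ Q S then X S else 0)
        = (∑' Q : W, if IsOuterNeighbor W ρ Q S then 1 else 0) * X S := by
          rw [← ENNReal.tsum_mul_right]
          simp only [ite_mul, one_mul, zero_mul]
      _ ≤ _ := by
          gcongr
          exact (hM Ω W hΩ hρ S).2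
  have hsum₃ : ∑' Q : W, volume Q.1.toSet * β Q ^ p ≤ C₃ * ∑' Q : W, X Q := by
    refine (hC₃ Ω W hΩ fun P => N P (u P)).trans ?_
    gcongr with P
    exact hub P
  calc ∫⁻ x in Ω, innerNorm s q f Ω x ^ p
      = ∑' Q : W, ∫⁻ x in Q.1.toSet, innerNorm s q f Ω x ^ p := hW.lintegral_eq_tsum _
    _ ≤ ∑' Q : W, K ^ p * 4 ^ p * (X Q +
          M ^ (p - 1) * (∑' S : W, if IsOuterNeighbor W ρ Q S then X S else 0) +
          volume Q.1.toSet * β Q ^ p) := ENNReal.tsum_le_tsum hint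
    _ = K ^ p * 4 ^ p * (∑' Q : W, X Q +
          M ^ (p - 1) * (∑' Q : W, ∑' S : W, if IsOuterNeighbor W ρ Q S then X S else 0) +
          ∑' Q : W, volume Q.1.toSet * β Q ^ p) := by
        rw [ENNReal.tsum_mul_left, ENNReal.tsum_add, ENNReal.tsum_add, ENNReal.tsum_mul_left]
    _ ≤ K ^ p * 4 ^ p * (∑' Q : W, X Q + M ^ (p - 1) * (M * ∑' Q : W, X Q) +
          C₃ * ∑' Q : W, X Q) := by gcongr
    _ = K ^ p * 4 ^ p * (1 + M ^ (p - 1) * M + C₃) * ∑' Q : W, X Q := by ring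
    _ = _ := by
        push_cast [ENNReal.coe_rpow_of_nonneg _ hp0,
          ENNReal.coe_rpow_of_nonneg _ (sub_nonneg.2 hp)]
        rfl

theorem exists_fullSeminorm_le (hd : 1 ≤ d) (hε : 0 < ε) (ρ : ℝ) (hs : 0 < s) (hp : 1 ≤ p)
    (hq : 1 ≤ q) : ∃ C : ℝ≥0, ∀ (Ω : Set (EuclideanSpace ℝ (Fin d))) (W : Set (DyadicCube d)),
      IsUniformDomainWith ε Ω W → IsShadowParameter ε W ρ →
      ∀ f : EuclideanSpace ℝ (Fin d) → ℂ, AEStronglyMeasurable f (volume.restrict Ω) →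
        fullSeminorm s p q Ω f ≤ C * shadowSeminorm s p q W ρ f := by
  obtain ⟨C, hC⟩ := exists_lintegral_innerNorm_le hd hε ρ hs hp hq
  have hp' : 0 ≤ 1 / p := by positivity
  refine ⟨C ^ (1 / p), fun Ω W hΩ hρ f hf => ?_⟩
  rw [fullSeminorm_congr hf.ae_eq_mk, shadowSeminorm_congr hΩ.whitney hf.ae_eq_mk]
  unfold fullSeminorm shadowSeminorm
  rw [ENNReal.coe_rpow_of_nonneg _ hp', ← ENNReal.mul_rpow_of_nonneg _ _ hp']
  gcongr
  exact hC Ω W hΩ hρ _ hf.stronglyMeasurable_mk.measurable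

end Comparison

end UniformDomain

theorem theoremA2 (d : ℕ) (hd : 1 ≤ d) (ε : ℝ) (hε : 0 < ε) :
    (∃ ρ : ℝ, ∀ (Ω : Set (EuclideanSpace ℝ (Fin d))) (W : Set (UniformDomain.DyadicCube d)),
      UniformDomain.IsUniformDomainWith ε Ω W → UniformDomain.IsShadowParameter ε W ρ) ∧
    ∀ (ρ s p : ℝ) (q : ℝ≥0∞), 0 < s → s < 1 → 1 ≤ p → 1 ≤ q →
      ∃ C : ℝ≥0, ∀ (Ω : Set (EuclideanSpace ℝ (Fin d))) (W : Set (UniformDomain.DyadicCube d)),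
        UniformDomain.IsUniformDomainWith ε Ω W → UniformDomain.IsShadowParameter ε W ρ →
        ∀ f : EuclideanSpace ℝ (Fin d) → ℂ, LocallyIntegrableOn f Ω →
          UniformDomain.shadowSeminorm s p q W ρ f ≤ C * UniformDomain.fullSeminorm s p q Ω f ∧
          UniformDomain.fullSeminorm s p q Ω f ≤ C * UniformDomain.shadowSeminorm s p q W ρ f := by
  refine ⟨?_, fun ρ s p q hs _ hp hq => ?_⟩
  · obtain ⟨ρ, hρ⟩ := UniformDomain.exists_isShadowParameter d hε
    exact ⟨ρ, fun _ W _ => hρ W⟩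
  · obtain ⟨C, hC⟩ := UniformDomain.exists_fullSeminorm_le hd hε ρ hs hp hq
    refine ⟨1 + C, fun Ω W hΩ hρ f hf => ⟨?_, ?_⟩⟩
    · refine (UniformDomain.shadowSeminorm_le_fullSeminorm hΩ.whitney hp hq).trans ?_
      rw [ENNReal.coe_add, add_mul, ENNReal.coe_one, one_mul]
      exact le_self_add
    · refine (hC Ω W hΩ hρ f hf.aestronglyMeasurable).trans ?_
      gcongr
      exact le_add_self
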